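/- Let $K_n=([n],E_n)$ be the complete graph. For edge weights $X=(X_e)_{e\in E_n}$ and a configuration $\gamma\in\{\pm1\}^n$ let $\mathrm{obj}_X(\gamma)=\sum_{\{u,v\}\in E_n}X_{\{u,v\}}\mathbf 1\{\gamma(u)\ne\gamma(v)\}$ be the weight of the cut given by $\gamma$. The algorithm 2-FLIP (for Max-Cut) starts from some configuration and, as long as flipping one or two entries of the current configuration can strictly increase $\mathrm{obj}_X$, performs one such flip; it never flips two entries if flipping only one of these two gives a strictly larger value of $\mathrm{obj}_X$ than flipping both. Pure 2-FLIP is the variant in which every step flips exactly two entries, and which stops when no flip of exactly two entries strictly increases $\mathrm{obj}_X$. An implementation consists of an arbitrary choice of the initial configuration and an arbitrary (possibly adaptive, weight-dependent or randomized) pivoting rule that selects the next step among the allowed ones. There is an absolute constant $C>0$ such that the following holds for every $n\ge 1$ and every $\phi>0$. Let $\mathcal X=(\mathcal X_e)_{e\in E_n}$ be probability distributions on $\mathbb R$, each supported on $[-1,1]$ and with a density function bounded from above by $\phi$, and let the weights $X_e\sim\mathcal X_e$ be drawn independently. Then for any implementation of 2-FLIP, and for any implementation of Pure 2-FLIP,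 the expected number of steps until termination is at most $$\phi\, n^{\,C\log^{10}n},$$ where $\log^{10}n=(\log n)^{10}$. -/

import Mathlib

open MeasureTheory ProbabilityTheory
open scoped ENNReal

noncomputable section

namespace LocalMaxCut

/-- The edges of the complete graph on the node set `Fin n`; the edge joining `u` and `v` is
represented by the pair with the smaller endpoint first. -/
abbrev Edge (n : ℕ) : Type := {p : Fin n × Fin n // p.1 < p.2}

/-- Edge weights of the complete graph on `n` nodes. -/
abbrev Weights (n : ℕ) : Type := Edge n → ℝ

/-- Configurations in `{1, -1}^n`, i.e. (ordered) bipartitions of the node set. -/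
abbrev Config (n : ℕ) : Type := Fin n → ℤˣ

/-- The weight of the cut given by the configuration `γ`. -/
def obj {n : ℕ} (X : Weights n) (γ : Config n) : ℝ :=
  ∑ e : Edge n, X e * (if γ e.1.1 ≠ γ e.1.2 then 1 else 0)

/-- A step of 2-FLIP from `γ` to `γ'`: at most two nodes are flipped, the cut strictly improves,
and two nodes are not flipped if flipping only one of them gives a cut that is strictly better
than the one obtained by flipping both. (`Function.update γ u (γ' u)` is `γ` with only the
node `u` flipped; if `u` is the only node flipped, the last clause holds trivially.) -/
structure TwoFlipStep {n : ℕ} (X : Weights n) (γ γ' : Config n) : Prop where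
  dist_le : hammingDist γ γ' ≤ 2
  improving : obj X γ < obj X γ'
  no_better_single : ∀ u, γ u ≠ γ' u → obj X (Function.update γ u (γ' u)) ≤ obj X γ'

/-- `γ` cannot be improved by flipping at most two nodes; 2-FLIP stops exactly there. -/
def TwoFlipOpt {n : ℕ} (X : Weights n) (γ : Config n) : Prop :=
  ∀ γ' : Config n, hammingDist γ γ' ≤ 2 → obj X γ' ≤ obj X γ

/-- A step of Pure 2-FLIP: exactly two nodes are flipped, and the cut strictly improves. -/
structure PureTwoFlipStep {n : ℕ} (X : Weights n) (γ γ' : Config n) : Prop where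
  dist_eq : hammingDist γ γ' = 2
  improving : obj X γ < obj X γ'

/-- `γ` cannot be improved by flipping exactly two nodes; Pure 2-FLIP stops exactly there. -/
def PureTwoFlipOpt {n : ℕ} (X : Weights n) (γ : Config n) : Prop :=
  ∀ γ' : Config n, hammingDist γ γ' = 2 → obj X γ' ≤ obj X γ

/-- `γ 0, γ 1, …` is an execution of the local search with steps `step` and stopping condition
`opt`: as long as the current configuration is not locally optimal, a step is made; once it is,
the algorithm has terminated, and the configuration stays put by convention. The initial
configuration and the choices among the possible steps are arbitrary. -/
def IsExecution {n : ℕ} (step : Config n → Config n → Prop) (opt : Config n → Prop)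
    (γ : ℕ → Config n) : Prop :=
  ∀ i, (¬ opt (γ i) → step (γ i) (γ (i + 1))) ∧ (opt (γ i) → γ (i + 1) = γ i)

/-- The number of steps until an execution terminates (`⊤` if it never does). -/
def numSteps {n : ℕ} (opt : Config n → Prop) (γ : ℕ → Config n) : ℕ∞ :=
  ⨅ k : {k : ℕ // opt (γ k)}, (k.1 : ℕ∞)

/-- `μ` is a probability distribution supported on `[-1, 1]` that has a density with respect to
Lebesgue measure bounded from above by `φ`. -/
structure IsSmoothed (φ : ℝ) (μ : Measure ℝ) : Prop where
  isProb : IsProbabilityMeasure μ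
  support : μ (Set.Icc (-1) 1)ᶜ = 0
  density : ∃ f : ℝ → ℝ≥0∞, Measurable f ∧ (∀ x, f x ≤ ENNReal.ofReal φ) ∧
    μ = volume.withDensity f

end LocalMaxCut

end

/-! In the signs `γ u`, the cut weight is, up to constants, the quadratic form `∑ X_e γ(u)γ(v)`. If
a window of improving steps gains at most `ε` in total, this random form is nearly constant along
it, which is unlikely once the quadratic functions on the window have large rank. A window of `q`
configurations has only polynomial-in-`n` to the power `q` move patterns, but recording the sides of
the nodes that never move would cost another `2^n`. Those sides change the quadratic columns only by
affine functions of the configuration. So the event is relaxed to "close to some affine function",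
which depends on the moves alone, and the relevant rank becomes `dim F² - dim F`, with `F` the space
of affine functions on the window.

A Kneser-type inequality for function spaces (`exists_le_mul_finrank_add_stab`) shows that for a
window cut into two parts, `d₁ + d₂ - dim F ≤ 5 (dim F² - dim F)`, with `d₁`, `d₂` the dimensions of
the restrictions (`finrank_map_funLeft_add_le`). If the right side were small on every dyadic block,
dimensions would almost add up from single points to at least `2^K / 2 > n + 1 ≥ dim F`, a
contradiction. Hence some block of length `q = 2^j` has rank at least `q / (10 K)`
(`exists_block_finrank_mul`).

For rank `p`, the relaxed event has probability at most `(4ηφ)^p (2q)^q` (`measure_nearAffine_le`).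
Since `q ≤ 10 K p`, the union bound over move patterns costs `(32 n² 2^K)^(10K)`, which is `n^{O(log
n)}` for `K` of order `log n` (`measure_slowWeights_le`). The bound is linear in `ε`, so summing
over dyadic scales of `ε` bounds the expectation. The only input from the algorithms is that a step
improves strictly and flips at most two nodes. -/

namespace LocalMaxCut

open scoped NNReal

/-! ### Growth of function spaces under multiplication -/

section Kneser

variable {A : Type*}

/-- The functions that map the function space `V` into itself by multiplication. -/
def stab (V : Submodule ℝ (A → ℝ)) : Submodule ℝ (A → ℝ) where
  carrier := {h | ∀ v ∈ V, h * v ∈ V}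
  add_mem' := fun ha hb v hv => by
    rw [add_mul]; exact V.add_mem (ha v hv) (hb v hv)
  zero_mem' := fun v _ => by rw [zero_mul]; exact V.zero_mem
  smul_mem' := fun c h hh v hv => by
    rw [smul_mul_assoc]; exact V.smul_mem c (hh v hv)

theorem stab_le {V : Submodule ℝ (A → ℝ)} (h1 : 1 ∈ V) : stab V ≤ V := fun h hh => by
  simpa using hh 1 h1

theorem mul_mem_stab {V : Submodule ℝ (A → ℝ)} {h k : A → ℝ} (hh : h ∈ stab V)
    (hk : k ∈ stab V) : h * k ∈ stab V := fun v hv => by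
  rw [mul_assoc]; exact hh _ (hk v hv)

theorem one_mem_stab (V : Submodule ℝ (A → ℝ)) : 1 ∈ stab V := fun v hv => by
  rwa [one_mul]

variable [Fintype A]

/-- A function space containing `1` is spanned by its units. -/
theorem mul_le_of_forall_unit {S T : Submodule ℝ (A → ℝ)} (hT : (1 : A → ℝ) ∈ T)
    (h : ∀ t ∈ T, (∀ a, t a ≠ 0) → ∀ s ∈ S, t * s ∈ T) :
    ∀ t ∈ T, ∀ s ∈ S, t * s ∈ T := by
  intro t ht s hs
  obtain ⟨c, hc⟩ : ∃ c : ℝ, ∀ a, t a + c ≠ 0 := by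
    obtain ⟨c, hc⟩ := (Set.finite_range fun a => -t a).exists_notMem
    exact ⟨c, fun a ha => hc ⟨a, by simp only; linarith⟩⟩
  have h1 := h (t + c • 1) (T.add_mem ht (T.smul_mem c hT)) (fun a => by simpa using hc a) s hs
  have h2 := h 1 hT (fun a => by simp) s hs
  have : t * s = (t + c • 1) * s - c • (1 * s) := by
    rw [add_mul, smul_mul_assoc]; abel
  rw [this]
  exact T.sub_mem h1 (T.smul_mem c h2)

/-- A linear version of Kneser's theorem for spaces of functions on a finite set. -/
theorem exists_le_mul_finrank_add_stab (S T : Submodule ℝ (A → ℝ)) (hS : 1 ∈ S) (hT : 1 ∈ T) :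
    ∃ V : Submodule ℝ (A → ℝ), T ≤ V ∧ V ≤ S * T ∧
      Module.finrank ℝ S + Module.finrank ℝ T
        ≤ Module.finrank ℝ V + Module.finrank ℝ (stab V) := by
  induction hn : Module.finrank ℝ S using Nat.strong_induction_on generalizing S T with
  | _ n ih =>
  -- If all units of `T` map `S` into `T`, then `S ≤ stab T` and `V = T` works. Otherwise a
  -- violating unit `t` drives a Dyson transform that makes `S` smaller.
  by_cases hst : ∀ t ∈ T, (∀ a, t a ≠ 0) → ∀ s ∈ S, t * s ∈ T
  · have hle : S ≤ stab T := fun s hs t ht => by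
      rw [mul_comm]; exact mul_le_of_forall_unit hT hst t ht s hs
    refine ⟨T, le_rfl, fun t ht => ?_, ?_⟩
    · simpa using Submodule.mul_mem_mul hS ht
    · have := Submodule.finrank_mono hle
      omega
  · push Not at hst
    obtain ⟨t, ht, hunit, s, hs, hts⟩ := hst
    let m : (A → ℝ) →ₗ[ℝ] (A → ℝ) := LinearMap.mulLeft ℝ t
    have hm : Function.Injective m := fun f g hfg => by
      ext a
      have := congrFun hfg a
      simpa [m, hunit a] using this
    -- The pair `S ∩ t⁻¹T`, `T + tS` has the same total dimension, because `T ∩ tS = tS'`. Its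
    -- product stays inside `S * T`: for `f ∈ S'` and `k ∈ S`, `f * (t * k) = k * (t * f)` with `t *
    -- f ∈ T`.
    set S' : Submodule ℝ (A → ℝ) := S ⊓ T.comap m with hS'
    set T' : Submodule ℝ (A → ℝ) := T ⊔ S.map m with hT'
    have hlt : S' < S := by
      refine lt_of_le_of_ne inf_le_left fun h => hts ?_
      have : s ∈ S' := h ▸ hs
      exact this.2
    have h1S' : (1 : A → ℝ) ∈ S' := ⟨hS, by simpa [m] using ht⟩
    have hdim : Module.finrank ℝ S' + Module.finrank ℝ T'
        = Module.finrank ℝ S + Module.finrank ℝ T := by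
      have h1 := Submodule.finrank_sup_add_finrank_inf_eq T (S.map m)
      have h2 : T ⊓ S.map m = S'.map m := by
        rw [hS']
        ext f
        simp only [Submodule.mem_inf, Submodule.mem_map, Submodule.mem_comap]
        constructor
        · rintro ⟨hf, g, hg, rfl⟩; exact ⟨g, ⟨hg, hf⟩, rfl⟩
        · rintro ⟨g, ⟨hg, hf⟩, rfl⟩; exact ⟨hf, g, hg, rfl⟩
      have e1 := LinearEquiv.finrank_eq (Submodule.equivMapOfInjective m hm S')
      have e2 := LinearEquiv.finrank_eq (Submodule.equivMapOfInjective m hm S)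
      rw [h2, ← hT'] at h1
      omega
    have hlt' := Submodule.finrank_lt_finrank_of_lt hlt
    obtain ⟨V, hV1, hV2, hV3⟩ := ih _ (hn ▸ hlt') S' T' h1S' (Submodule.mem_sup_left hT) rfl
    refine ⟨V, le_sup_left.trans hV1, hV2.trans ?_, by omega⟩
    rw [Submodule.mul_le]
    rintro f ⟨hf, hf'⟩ g hg
    obtain ⟨g1, hg1, g2, hg2, rfl⟩ := Submodule.mem_sup.1 hg
    obtain ⟨k, hk, rfl⟩ := Submodule.mem_map.1 hg2
    rw [mul_add]
    refine Submodule.add_mem _ (Submodule.mul_mem_mul hf hg1) ?_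
    have : f * m k = k * (m f) := by simp only [m, LinearMap.mulLeft_apply]; ring
    rw [this]
    exact Submodule.mul_mem_mul hk hf'

/-- If `h` and `v * h` stabilize `V`, and `v` separates points, then `f * h` stabilizes `V` for
every function `f`. -/
theorem mul_mem_stab_of_injective {V : Submodule ℝ (A → ℝ)} {v h : A → ℝ}
    (hv : Function.Injective v) (hh : h ∈ stab V) (hvh : v * h ∈ stab V) (f : A → ℝ) :
    f * h ∈ stab V := by
  classical
  have hpow : ∀ k : ℕ, ∀ g ∈ stab V, g ^ k ∈ stab V := by
    intro k g hg
    induction k with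
    | zero => rw [pow_zero]; exact one_mem_stab V
    | succ k ih => rw [pow_succ]; exact mul_mem_stab ih hg
  have hpoly : ∀ P : Polynomial ℝ, ∀ g ∈ stab V, (fun a => P.eval (g a)) ∈ stab V := by
    intro P g hg
    have : (fun a => P.eval (g a)) = ∑ i ∈ P.support, P.coeff i • g ^ i := by
      ext a
      simp [Polynomial.eval_eq_sum, Polynomial.sum_def]
    rw [this]
    exact Submodule.sum_mem _ fun i _ => Submodule.smul_mem _ _ (hpow i g hg)
  -- The pointwise pseudo-inverse of `h` is a polynomial in `h`, by interpolation on its finitely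
  -- many values. Multiplying `v * h` by it gives `w`, which equals `v` on the support of `h`.
  have hind : (fun a => if h a = 0 then (0 : ℝ) else (h a)⁻¹) ∈ stab V := by
    convert hpoly (Lagrange.interpolate (Finset.univ.image h) id fun x => if x = 0 then 0 else x⁻¹)
      h hh with a
    exact (Lagrange.eval_interpolate_at_node (v := id) (fun x : ℝ => if x = 0 then 0 else x⁻¹)
      (Set.injOn_id _) (Finset.mem_image_of_mem h (Finset.mem_univ a))).symm
  have hw := mul_mem_stab hvh hind
  set w := v * h * fun a => if h a = 0 then (0 : ℝ) else (h a)⁻¹ with hwdef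
  have hwa : ∀ a, h a ≠ 0 → w a = v a := fun a ha => by simp [hwdef, ha]
  -- As `v` separates points, `f = P(v)` for a polynomial `P`; then `P(w) * h = f * h`, since both
  -- sides vanish where `h` does.
  have := mul_mem_stab (hpoly (Lagrange.interpolate Finset.univ v f) w hw) hh
  convert this using 1
  ext a
  by_cases ha : h a = 0
  · simp [ha]
  · simp only [Pi.mul_apply, hwa a ha]
    rw [Lagrange.eval_interpolate_at_node _ hv.injOn (Finset.mem_univ a)]

/-- Since `vH + H ≤ V`, the space `H₀` has dimension at least `2 dim H - dim V`. Multiplication by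
`ρ` keeps `H₀` inside `H`, so `dim (ρH + H) ≤ 2 dim H - dim H₀ ≤ dim V`. A complement of `H` in `V`
contributes at most `2 (dim V - dim H)` more to `W`. It is applied with `H = stab V` and `ρ` the
indicator of one part. -/
theorem finrank_le_add_of_mulLeft {H W V : Submodule ℝ (A → ℝ)} (hHV : H ≤ V) (ρ : A → ℝ)
    (hW : W = V ⊔ V.map (LinearMap.mulLeft ℝ ρ)) {v : A → ℝ}
    (hv : ∀ h ∈ H, v * h ∈ V) (hker : ∀ h ∈ H, v * h ∈ H → ρ * h ∈ H) :
    Module.finrank ℝ W + 2 * Module.finrank ℝ H ≤ 3 * Module.finrank ℝ V := by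
  -- count dimensions of the kernel `H₀` of `h ↦ v * h mod H`
  set H₀ : Submodule ℝ (A → ℝ) := H ⊓ H.comap (LinearMap.mulLeft ℝ v) with hH₀
  have hmap : ∀ (c : A → ℝ) (X K : Submodule ℝ (A → ℝ)), K = H ⊓ X.comap (LinearMap.mulLeft ℝ c) →
      Module.finrank ℝ H ≤ Module.finrank ℝ (H.map (LinearMap.mulLeft ℝ c) ⊔ X : Submodule ℝ _)
        - Module.finrank ℝ X + Module.finrank ℝ K ∧
      Module.finrank ℝ (H.map (LinearMap.mulLeft ℝ c) ⊔ X : Submodule ℝ _) + Module.finrank ℝ K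
        ≤ Module.finrank ℝ X + Module.finrank ℝ H := by
    intro c X K hK
    let q : H →ₗ[ℝ] ((A → ℝ) ⧸ X) := X.mkQ ∘ₗ (LinearMap.mulLeft ℝ c) ∘ₗ H.subtype
    have h1 := LinearMap.finrank_range_add_finrank_ker q
    have hk : Module.finrank ℝ (LinearMap.ker q) = Module.finrank ℝ K := by
      have : K = (LinearMap.ker q).map H.subtype := by
        rw [hK]
        ext f
        simp only [Submodule.mem_inf, Submodule.mem_comap, Submodule.mem_map, LinearMap.mem_ker, q,
          LinearMap.comp_apply, Submodule.mkQ_apply, Submodule.Quotient.mk_eq_zero]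
        constructor
        · rintro ⟨a, b⟩; exact ⟨⟨f, a⟩, b, rfl⟩
        · rintro ⟨⟨g, a⟩, b, rfl⟩; exact ⟨a, b⟩
      rw [this]
      exact LinearEquiv.finrank_eq
        (Submodule.equivMapOfInjective H.subtype H.injective_subtype (LinearMap.ker q))
    have hr : LinearMap.range q = (H.map (LinearMap.mulLeft ℝ c) ⊔ X).map X.mkQ := by
      rw [LinearMap.range_comp, LinearMap.range_comp, Submodule.range_subtype, Submodule.map_sup,
        Submodule.mkQ_map_self, sup_bot_eq]
    have h2 : Module.finrank ℝ ((H.map (LinearMap.mulLeft ℝ c) ⊔ X).map X.mkQ)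
        + Module.finrank ℝ X
        = Module.finrank ℝ (H.map (LinearMap.mulLeft ℝ c) ⊔ X : Submodule ℝ _) := by
      set Y := H.map (LinearMap.mulLeft ℝ c) ⊔ X with hY
      have h3 := LinearMap.finrank_range_add_finrank_ker (X.mkQ.domRestrict Y)
      rw [LinearMap.range_domRestrict] at h3
      have h4 : X = (LinearMap.ker (X.mkQ.domRestrict Y)).map Y.subtype := by
        ext f
        simp only [Submodule.mem_map, LinearMap.mem_ker, LinearMap.domRestrict_apply,
          Submodule.mkQ_apply, Submodule.Quotient.mk_eq_zero]
        constructor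
        · intro hf; exact ⟨⟨f, Submodule.mem_sup_right hf⟩, hf, rfl⟩
        · rintro ⟨g, hg, rfl⟩; exact hg
      have h5 := LinearEquiv.finrank_eq
        (Submodule.equivMapOfInjective Y.subtype Y.injective_subtype
          (LinearMap.ker (X.mkQ.domRestrict Y)))
      rw [← h4] at h5
      omega
    rw [hr] at h1
    omega
  have hA := (hmap v H H₀ hH₀).1
  have hAle : Module.finrank ℝ (H.map (LinearMap.mulLeft ℝ v) ⊔ H : Submodule ℝ _)
      ≤ Module.finrank ℝ V := by
    refine Submodule.finrank_mono (sup_le ?_ hHV)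
    rintro _ ⟨h, hh, rfl⟩
    exact hv h hh
  have hB := (hmap ρ H _ rfl).2
  have hBle : Module.finrank ℝ H₀
      ≤ Module.finrank ℝ (H ⊓ H.comap (LinearMap.mulLeft ℝ ρ) : Submodule ℝ _) := by
    refine Submodule.finrank_mono fun h hh => ⟨hh.1, hker h hh.1 hh.2⟩
  have hHle := Submodule.finrank_mono hHV
  -- a complement of `H` in `V`
  obtain ⟨U, hU1, hU2⟩ : ∃ U : Submodule ℝ (A → ℝ), H ⊔ U = V ∧
      Module.finrank ℝ U + Module.finrank ℝ H = Module.finrank ℝ V := by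
    obtain ⟨U, hU⟩ := Submodule.exists_isCompl H
    have hsup : H ⊔ U ⊓ V = V := by
      rw [← sup_inf_assoc_of_le U hHV, hU.sup_eq_top, top_inf_eq]
    refine ⟨U ⊓ V, hsup, ?_⟩
    · have h1 := Submodule.finrank_sup_add_finrank_inf_eq H (U ⊓ V)
      rw [← inf_assoc, hU.inf_eq_bot, bot_inf_eq, finrank_bot, hsup] at h1
      omega
  have hWle : W ≤ (H.map (LinearMap.mulLeft ℝ ρ) ⊔ H) ⊔ (U ⊔ U.map (LinearMap.mulLeft ℝ ρ)) := by
    rw [hW, ← hU1, Submodule.map_sup]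
    refine sup_le (sup_le ?_ ?_) (sup_le ?_ ?_)
    · exact le_sup_right.trans le_sup_left
    · exact le_sup_left.trans le_sup_right
    · exact le_sup_left.trans le_sup_left
    · exact le_sup_right.trans le_sup_right
  have hW1 := Submodule.finrank_mono hWle
  have hW2 := Submodule.finrank_add_le_finrank_add_finrank
    (H.map (LinearMap.mulLeft ℝ ρ) ⊔ H) (U ⊔ U.map (LinearMap.mulLeft ℝ ρ))
  have hW3 := Submodule.finrank_add_le_finrank_add_finrank U (U.map (LinearMap.mulLeft ℝ ρ))
  have hW4 : Module.finrank ℝ (U.map (LinearMap.mulLeft ℝ ρ)) ≤ Module.finrank ℝ U :=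
    Submodule.finrank_map_le _ _
  omega

/-- The connectivity of a partition is bounded by five times the growth of the function space `F`
under squaring. -/
theorem finrank_map_funLeft_add_le {A₁ A₂ : Type*} [Fintype A₁] [Fintype A₂]
    (i₁ : A₁ → A) (i₂ : A₂ → A) (hi : ∀ a b, i₁ a ≠ i₂ b)
    (F : Submodule ℝ (A → ℝ)) (h1 : 1 ∈ F) {v : A → ℝ} (hvF : v ∈ F) (hv : Function.Injective v) :
    Module.finrank ℝ (F.map (LinearMap.funLeft ℝ ℝ i₁))
      + Module.finrank ℝ (F.map (LinearMap.funLeft ℝ ℝ i₂)) + 4 * Module.finrank ℝ F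
      ≤ 5 * Module.finrank ℝ (F * F : Submodule ℝ (A → ℝ)) := by
  classical
  obtain ⟨V, hFV, hVF, hdim⟩ := exists_le_mul_finrank_add_stab F F h1 h1
  let ρ : A → ℝ := fun a => if a ∈ Set.range i₁ then 1 else 0
  have hρ1 : ∀ a, ρ (i₁ a) = 1 := fun a => by simp [ρ]
  have hρ2 : ∀ b, ρ (i₂ b) = 0 := fun b => by simp [ρ, hi]
  -- With `ρ` the indicator of the first part, `W` contains every gluing of two members of `F`
  -- restricted to the two parts. Hence `d₁ + d₂ ≤ dim W ≤ 3 dim V - 2 dim (stab V) ≤ 5 dim V - 4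
  -- dim F`, the last step by the Kneser inequality for `S = T = F`.
  set W := V ⊔ V.map (LinearMap.mulLeft ℝ ρ) with hW
  have hmain := finrank_le_add_of_mulLeft (stab_le (hFV h1)) ρ hW (v := v)
    (fun h hh => by rw [mul_comm]; exact hh v (hFV hvF))
    (fun h hh hvh => mul_mem_stab_of_injective hv hh hvh ρ)
  let Φ : (A → ℝ) →ₗ[ℝ] (A₁ → ℝ) × (A₂ → ℝ) :=
    (LinearMap.funLeft ℝ ℝ i₁).prod (LinearMap.funLeft ℝ ℝ i₂)
  have hle : (F.map (LinearMap.funLeft ℝ ℝ i₁)).prod (F.map (LinearMap.funLeft ℝ ℝ i₂))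
      ≤ W.map Φ := by
    rintro ⟨f', g'⟩ ⟨⟨f, hf, rfl⟩, ⟨g, hg, rfl⟩⟩
    refine ⟨g + ρ * (f - g), ?_, ?_⟩
    · refine Submodule.add_mem _ (Submodule.mem_sup_left (hFV hg)) (Submodule.mem_sup_right ?_)
      exact ⟨f - g, V.sub_mem (hFV hf) (hFV hg), rfl⟩
    · ext a
      · simp [Φ, LinearMap.funLeft_apply, hρ1]
      · simp [Φ, LinearMap.funLeft_apply, hρ2]
  have h2 := Submodule.finrank_mono hle
  have h3 : Module.finrank ℝ (W.map Φ) ≤ Module.finrank ℝ W := Submodule.finrank_map_le _ _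
  have h4 : Module.finrank ℝ (F.map (LinearMap.funLeft ℝ ℝ i₁))
        + Module.finrank ℝ (F.map (LinearMap.funLeft ℝ ℝ i₂)) ≤ Module.finrank ℝ
      ((F.map (LinearMap.funLeft ℝ ℝ i₁)).prod (F.map (LinearMap.funLeft ℝ ℝ i₂))) := by
    rw [← Module.finrank_prod]
    let ψ := ((F.map (LinearMap.funLeft ℝ ℝ i₁)).subtype.prodMap
      (F.map (LinearMap.funLeft ℝ ℝ i₂)).subtype).codRestrict
      ((F.map (LinearMap.funLeft ℝ ℝ i₁)).prod (F.map (LinearMap.funLeft ℝ ℝ i₂)))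
      fun x => ⟨x.1.2, x.2.2⟩
    refine LinearMap.finrank_le_finrank_of_injective (f := ψ) fun x y hxy => ?_
    have h := congrArg Subtype.val hxy
    exact Prod.ext (Subtype.ext (congrArg Prod.fst h)) (Subtype.ext (congrArg Prod.snd h))
  have h5 := Submodule.finrank_mono hVF
  omega

end Kneser

/-! ### Affine functions along a sequence, and a block of large quadratic rank -/

/-- The affine coordinate functions `1, γ ↦ γ u` along a family of configurations. -/
def affineCol {n : ℕ} {A : Type*} (y : A → Config n) : Option (Fin n) → A → ℝ
  | none => 1
  | some u => fun t => ((y t u : ℤ) : ℝ)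

/-- The space of affine functions of the configuration along a family of configurations. -/
def affineFun {n : ℕ} {A : Type*} (y : A → Config n) : Submodule ℝ (A → ℝ) :=
  Submodule.span ℝ (Set.range (affineCol y))

section

variable {n : ℕ} {A : Type*} (y : A → Config n)

theorem affineCol_mem (o : Option (Fin n)) : affineCol y o ∈ affineFun y :=
  Submodule.subset_span ⟨o, rfl⟩

theorem one_mem_affineFun : 1 ∈ affineFun y := affineCol_mem y none

theorem coord_mem_affineFun (u : Fin n) : (fun t => ((y t u : ℤ) : ℝ)) ∈ affineFun y :=
  affineCol_mem y (some u)

theorem map_funLeft_affineFun {B : Type*} (i : B → A) :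
    (affineFun y).map (LinearMap.funLeft ℝ ℝ i) = affineFun (y ∘ i) := by
  rw [affineFun, Submodule.map_span, affineFun, ← Set.range_comp]
  congr 2
  ext o t
  cases o <;> rfl

theorem finrank_affineFun_le [Fintype A] : Module.finrank ℝ (affineFun y) ≤ n + 1 := by
  refine (finrank_range_le_card (R := ℝ) (affineCol y)).trans ?_
  simp

/-- Coordinates separate distinct configurations, so for each pair of indices the functions failing
to separate it form a proper subspace. Some member of the space avoids these finitely many
subspaces. -/
theorem exists_injective_mem_affineFun [Finite A] (hy : Function.Injective y) :
    ∃ v ∈ affineFun y, Function.Injective v := by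
  let ι := {p : A × A // p.1 ≠ p.2}
  have hex : ∀ p : ι, ∃ x ∈ affineFun y, x p.1.1 - x p.1.2 ≠ 0 := by
    rintro ⟨⟨a, b⟩, hab⟩
    obtain ⟨u, hu⟩ := Function.ne_iff.1 (hy.ne hab)
    refine ⟨_, coord_mem_affineFun y u, fun h => ?_⟩
    have h' : ((y a u : ℤ) : ℝ) = ((y b u : ℤ) : ℝ) := sub_eq_zero.1 h
    exact hu (Units.ext (by exact_mod_cast h'))
  obtain ⟨v, hv, h⟩ := Module.Dual.exists_forall_mem_ne_zero_of_forall_exists (K := ℝ)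
    (affineFun y) (fun p : ι =>
      { toFun := fun x => x p.1.1 - x p.1.2
        map_add' := fun x y => by simp only [Pi.add_apply]; ring
        map_smul' := fun c x => by simp [mul_sub] }) hex
  refine ⟨v, hv, fun a b hab => ?_⟩
  by_contra hne
  exact h ⟨(a, b), hne⟩ (sub_eq_zero.2 hab)

end

/-- A block of `2 ^ j` configurations of a sequence. -/
def block {n : ℕ} (z : ℕ → Config n) (a q : ℕ) : Fin q → Config n := fun t => z (a + t)

/-- A long sequence of distinct configurations has a dyadic block on which many quadratic functions
are independent modulo the affine functions. -/
theorem exists_block_finrank_mul {n K : ℕ} (z : ℕ → Config n)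
    (hz : Set.InjOn z (Set.Iio (2 ^ K))) (hK : 2 * (n + 1) < 2 ^ K) :
    ∃ j a : ℕ, 1 ≤ j ∧ j ≤ K ∧ a + 2 ^ j ≤ 2 ^ K ∧
      2 ^ j + 10 * K * Module.finrank ℝ (affineFun (block z a (2 ^ j))) ≤ 10 * K *
        Module.finrank ℝ (affineFun (block z a (2 ^ j)) * affineFun (block z a (2 ^ j)) :
          Submodule ℝ (Fin (2 ^ j) → ℝ)) := by
  by_contra! hcon
  have hK0 : 0 < K := by
    rcases Nat.eq_zero_or_pos K with rfl | h
    · omega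
    · exact h
  -- Dividing by `2K`: the dimension on a block of length `2^j` is at least `2^j (1 - j / (2K))`.
  -- Each merge of two halves loses at most five times the assumed deficit `2^j / (10K)`. At `j = K`
  -- half of `2^K` survives, which exceeds `n + 1`.
  have key : ∀ j a : ℕ, j ≤ K → a + 2 ^ j ≤ 2 ^ K →
      2 * K * 2 ^ j ≤ 2 * K * Module.finrank ℝ (affineFun (block z a (2 ^ j))) + j * 2 ^ j := by
    intro j
    induction j with
    | zero =>
      intro a _ _
      have : 0 < Module.finrank ℝ (affineFun (block z a (2 ^ 0))) := by
        have : Nontrivial (affineFun (block z a (2 ^ 0))) :=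
          ⟨⟨0, ⟨1, one_mem_affineFun _⟩, fun h => by
            have h1 := congrFun (congrArg Subtype.val h) ⟨0, by simp⟩
            simp at h1⟩⟩
        exact Module.finrank_pos
      simp only [pow_zero, mul_one, add_zero]
      exact Nat.le_mul_of_pos_right _ this
    | succ j ih =>
      intro a hj ha
      have h2 : 2 ^ (j + 1) = 2 ^ j + 2 ^ j := by ring
      have hc := hcon (j + 1) a (by omega) hj ha
      rw [h2] at ha hc ⊢
      have hinj : Function.Injective (block z a (2 ^ j + 2 ^ j)) := fun s t hst => by
        have := hz (by simp only [Set.mem_Iio]; omega) (by simp only [Set.mem_Iio]; omega) hst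
        exact Fin.ext (by omega)
      obtain ⟨v, hv, hvi⟩ := exists_injective_mem_affineFun _ hinj
      have h5 := finrank_map_funLeft_add_le (Fin.castAdd (2 ^ j)) (Fin.natAdd (2 ^ j))
        (fun s t h => by have := congrArg Fin.val h; simp at this; omega) _
        (one_mem_affineFun _) hv hvi
      rw [map_funLeft_affineFun, map_funLeft_affineFun] at h5
      have e1 : block z a (2 ^ j + 2 ^ j) ∘ Fin.castAdd (2 ^ j) = block z a (2 ^ j) := rfl
      have e2 : block z a (2 ^ j + 2 ^ j) ∘ Fin.natAdd (2 ^ j) = block z (a + 2 ^ j) (2 ^ j) := by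
        funext t; exact congrArg z (by simp only [Fin.val_natAdd]; omega)
      rw [e1, e2] at h5
      have i1 := ih a (by omega) (by have := Nat.zero_le (2 ^ j); omega)
      have i2 := ih (a + 2 ^ j) (by omega) (by rwa [add_assoc])
      have h6 := Nat.mul_le_mul_left (2 * K) h5
      nlinarith
  have h1 := key K 0 le_rfl (by omega)
  have h2 := Nat.mul_le_mul_left (2 * K) (finrank_affineFun_le (block z 0 (2 ^ K)))
  have h3 : 2 * K * 2 ^ K ≤ 2 * K * (n + 1) + K * 2 ^ K := by omega
  have h4 : K * (2 * (n + 1)) < K * 2 ^ K := Nat.mul_lt_mul_of_pos_left hK hK0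
  nlinarith

/-! ### Anti-concentration of linear forms -/

/-- Domination of measures passes to finite products. -/
theorem pi_apply_le_of_le_smul_volume {ι : Type*} [Fintype ι] (ν : ι → Measure ℝ)
    [∀ i, SigmaFinite (ν i)] (c : ι → ℝ≥0) (h : ∀ i, ν i ≤ c i • volume)
    {s : Set (ι → ℝ)} (hs : MeasurableSet s) :
    Measure.pi ν s ≤ (∏ i, (c i : ℝ≥0∞)) * volume s := by
  have h1 : Measure.pi (fun i => c i • (volume : Measure ℝ)) = (∏ i, c i) • volume := by
    refine Measure.pi_eq fun t _ => ?_
    rw [Measure.smul_apply, volume_pi_pi]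
    simp only [Measure.smul_apply, ENNReal.smul_def, smul_eq_mul, Finset.prod_mul_distrib,
      ENNReal.ofNNReal_finsetProd]
  -- The product outer measure is the largest one bounded on boxes by the products of the side
  -- measures, so the comparison need only be made on boxes.
  have h2 : (Measure.pi ν).toOuterMeasure
      ≤ OuterMeasure.pi fun i => (c i • (volume : Measure ℝ)).toOuterMeasure := by
    rw [OuterMeasure.le_pi]
    intro t _
    change Measure.pi ν (Set.pi Set.univ t) ≤ ∏ i, (c i • (volume : Measure ℝ)) (t i)
    rw [Measure.pi_pi]
    exact Finset.prod_le_prod' fun i _ => h i (t i)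
  have h3 : Measure.pi (fun i => c i • (volume : Measure ℝ)) s
      = OuterMeasure.pi (fun i => (c i • (volume : Measure ℝ)).toOuterMeasure) s := by
    rw [Measure.pi, toMeasure_apply _ _ hs]
  calc Measure.pi ν s ≤ Measure.pi (fun i => c i • (volume : Measure ℝ)) s := by
        rw [h3]; exact h2 s
    _ = (∏ i, (c i : ℝ≥0∞)) * volume s := by
        rw [h1, Measure.smul_apply, ENNReal.smul_def, smul_eq_mul, ENNReal.ofNNReal_finsetProd]

/-- The volume of a box transformed by a matrix with determinant at least one. -/
theorem volume_affine_box_le {J : Type*} [Fintype J] [DecidableEq J] (M : Matrix J J ℝ)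
    (hM : 1 ≤ |M.det|) (b : J → ℝ) (r : ℝ) :
    volume {x : J → ℝ | ∀ j, |M.mulVec x j + b j| ≤ r}
      ≤ ENNReal.ofReal (2 * r) ^ Fintype.card J := by
  have hdet : LinearMap.det (Matrix.toLin' M) ≠ 0 := by
    rw [LinearMap.det_toLin']
    intro h
    rw [h, abs_zero] at hM
    linarith
  have heq : {x : J → ℝ | ∀ j, |M.mulVec x j + b j| ≤ r}
      = Matrix.toLin' M ⁻¹' Set.pi Set.univ fun j => Set.Icc (-r - b j) (r - b j) := by
    ext x
    simp only [Set.mem_ofPred_eq, Set.mem_preimage, Set.mem_univ_pi, Set.mem_Icc,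
      Matrix.toLin'_apply, abs_le]
    refine forall_congr' fun j => ?_
    constructor <;> rintro ⟨h1, h2⟩ <;> constructor <;> linarith
  rw [heq, Measure.addHaar_preimage_linearMap _ hdet, volume_pi_pi, LinearMap.det_toLin']
  have h1 : ENNReal.ofReal |(M.det)⁻¹| ≤ 1 := by
    rw [abs_inv]
    exact ENNReal.ofReal_le_one.2 (inv_le_one_of_one_le₀ hM)
  have h2 : ∏ j, volume (Set.Icc (-r - b j) (r - b j)) = ENNReal.ofReal (2 * r) ^ Fintype.card J := by
    rw [Finset.prod_congr rfl fun j _ => by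
      rw [Real.volume_Icc, show r - b j - (-r - b j) = 2 * r by ring]]
    rw [Finset.prod_const, Finset.card_univ]
  rw [h2]
  exact mul_le_of_le_one_left' h1

/-- Anti-concentration for linear forms in independent variables, some of which have bounded
density, for which the forms have a minor of absolute value at least one. -/
theorem pi_forall_abs_sum_le {ι : Type*} [Fintype ι] (p : ι → Prop) [DecidablePred p]
    [DecidableEq {i // p i}] (ν : ι → Measure ℝ) [∀ i, SigmaFinite (ν i)] (c : {i // p i} → ℝ≥0)
    (hc : ∀ i : {i // p i}, ν i ≤ c i • volume) (hν : ∀ i, ¬ p i → IsProbabilityMeasure (ν i))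
    (M : {i // p i} → ι → ℝ) (hM : 1 ≤ |(Matrix.of fun j i : {i // p i} => M j i).det|) (r : ℝ) :
    Measure.pi ν {w | ∀ j, |∑ i, M j i * w i| ≤ r}
      ≤ (∏ i, (c i : ℝ≥0∞)) * ENNReal.ofReal (2 * r) ^ Fintype.card {i // p i} := by
  set S : Set (ι → ℝ) := {w | ∀ j, |∑ i, M j i * w i| ≤ r}
  set S' : Set (({i // p i} → ℝ) × ({i // ¬ p i} → ℝ)) :=
    {x | ∀ j, |∑ i : {i // p i}, M j i * x.1 i + ∑ i : {i // ¬ p i}, M j i * x.2 i| ≤ r}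
  have hS' : MeasurableSet S' := by
    rw [show S' = ⋂ j, {x | |∑ i : {i // p i}, M j i * x.1 i
      + ∑ i : {i // ¬ p i}, M j i * x.2 i| ≤ r} by ext; simp [S']]
    exact MeasurableSet.iInter fun j => measurableSet_le (by fun_prop) measurable_const
  have hpre : S = MeasurableEquiv.piEquivPiSubtypeProd (fun _ => ℝ) p ⁻¹' S' := by
    ext w
    simp only [S, S', Set.mem_ofPred_eq, Set.mem_preimage]
    refine forall_congr' fun j => ?_
    rw [← Fintype.sum_subtype_add_sum_subtype p fun i => M j i * w i]
    rfl
  rw [hpre, (measurePreserving_piEquivPiSubtypeProd ν p).measure_preimage hS'.nullMeasurableSet,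
    Measure.prod_apply_symm hS']
  have : ∀ i : {i // ¬ p i}, IsProbabilityMeasure (ν i) := fun i => hν i i.2
  -- With the variables outside `p` frozen, the forms are a square system in the remaining ones,
  -- shifted by constants.
  refine (lintegral_mono (g := fun _ => (∏ i, (c i : ℝ≥0∞))
    * ENNReal.ofReal (2 * r) ^ Fintype.card {i // p i}) fun y => ?_).trans ?_
  · refine (pi_apply_le_of_le_smul_volume (fun i : {i // p i} => ν i) c hc
      (measurable_prodMk_right hS')).trans ?_
    exact mul_le_mul' le_rfl
      (volume_affine_box_le _ hM (fun j => ∑ i : {i // ¬ p i}, M j i * y i) r)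
  · simp

/-! ### Quadratic forms close to an affine function -/

/-- The product of the signs of the endpoints of an edge, along a family of configurations. -/
def edgeCol {n : ℕ} {A : Type*} (y : A → Config n) (e : Edge n) : A → ℝ :=
  fun t => ((y t e.1.1 : ℤ) : ℝ) * ((y t e.1.2 : ℤ) : ℝ)

/-- The quadratic, the affine and the point functions on a family of configurations. -/
def allCol {n : ℕ} {A : Type*} [DecidableEq A] (y : A → Config n) :
    Edge n ⊕ (Option (Fin n) ⊕ A) → A → ℝ :=
  Sum.elim (edgeCol y) (Sum.elim (affineCol y) fun a => Pi.single a 1)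

section

variable {n : ℕ} {A : Type*} (y : A → Config n)

theorem sign_mul_self (x : ℤˣ) : ((x : ℤ) : ℝ) * ((x : ℤ) : ℝ) = 1 := by
  rcases Int.units_eq_one_or x with rfl | rfl <;> simp

theorem affineFun_mul_self_le :
    affineFun y * affineFun y
      ≤ Submodule.span ℝ (Set.range (edgeCol y) ∪ Set.range (affineCol y)) := by
  rw [affineFun, Submodule.span_mul_span, Submodule.span_le]
  have haff : ∀ o, affineCol y o ∈
      Submodule.span ℝ (Set.range (edgeCol y) ∪ Set.range (affineCol y)) :=
    fun o => Submodule.subset_span (Or.inr ⟨o, rfl⟩)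
  rintro _ ⟨_, ⟨o, rfl⟩, _, ⟨o', rfl⟩, rfl⟩
  change affineCol y o * affineCol y o' ∈ _
  rcases o with _ | u
  · rw [show affineCol y none * affineCol y o' = affineCol y o' from one_mul _]
    exact haff o'
  rcases o' with _ | v
  · rw [show affineCol y (some u) * affineCol y none = affineCol y (some u) from mul_one _]
    exact haff _
  rcases lt_trichotomy u v with h | rfl | h
  · exact Submodule.subset_span (Or.inl ⟨⟨(u, v), h⟩, rfl⟩)
  · rw [show affineCol y (some u) * affineCol y (some u) = affineCol y none from
      funext fun t => sign_mul_self (y t u)]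
    exact haff _
  · rw [mul_comm]
    exact Submodule.subset_span (Or.inl ⟨⟨(v, u), h⟩, rfl⟩)

theorem exists_int_allCol [DecidableEq A] (k : Edge n ⊕ (Option (Fin n) ⊕ A)) (t : A) :
    ∃ m : ℤ, allCol y k t = m ∧ |m| ≤ 1 := by
  have hs : ∀ x : ℤˣ, |(x : ℤ)| ≤ 1 := fun x => by
    rcases Int.units_eq_one_or x with rfl | rfl <;> simp
  rcases k with e | o | a
  · refine ⟨y t e.1.1 * y t e.1.2, by simp [allCol, edgeCol], ?_⟩
    exact_mod_cast hs (y t e.1.1 * y t e.1.2)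
  · rcases o with _ | u
    · exact ⟨1, by simp [allCol, affineCol], by simp⟩
    · exact ⟨y t u, by simp [allCol, affineCol], hs _⟩
  · by_cases h : t = a
    · exact ⟨1, by simp [allCol, h], by simp⟩
    · exact ⟨0, by simp [allCol, h], by simp⟩

theorem abs_allCol_le [DecidableEq A] (k : Edge n ⊕ (Option (Fin n) ⊕ A)) (t : A) :
    |allCol y k t| ≤ 1 := by
  obtain ⟨m, hm, hm1⟩ := exists_int_allCol y k t
  rw [hm]
  exact_mod_cast hm1

/-- There is a basis of the function space consisting of columns, which contains a basis of the
affine functions and many quadratic columns. -/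
theorem exists_column_basis [Fintype A] [DecidableEq A] :
    ∃ s : Finset (Edge n ⊕ (Option (Fin n) ⊕ A)),
      affineFun y ≤ Submodule.span ℝ (affineCol y '' {o | Sum.inr (Sum.inl o) ∈ s}) ∧
      LinearIndependent ℝ (fun k : s => allCol y k) ∧
      s.card = Fintype.card A ∧
      Module.finrank ℝ (affineFun y * affineFun y : Submodule ℝ (A → ℝ))
        ≤ s.toLeft.card
          + Module.finrank ℝ (affineFun y) := by
  classical
  let c := allCol y
  let aff : Set (Edge n ⊕ (Option (Fin n) ⊕ A)) := Set.range fun o => Sum.inr (Sum.inl o)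
  -- The order of the greedy extension matters: affine columns come first, so at most `dim F` of the
  -- independent columns spanning `F²` are affine and the rest are edges. Point columns then
  -- complete a basis of all functions.
  obtain ⟨s₀, hs₀, -, hspan₀, hind₀⟩ :=
    exists_linearIndepOn_extension (linearIndepOn_empty ℝ c) (Set.empty_subset aff)
  obtain ⟨s₁, hs₁, h01, hspan₁, hind₁⟩ :=
    exists_linearIndepOn_extension hind₀ (hs₀.trans (Set.subset_union_right (s := Set.range Sum.inl)))
  obtain ⟨s₂, -, h12, hspan₂, hind₂⟩ :=
    exists_linearIndepOn_extension hind₁ (Set.subset_univ s₁)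
  have hfin : ∀ t : Set (Edge n ⊕ (Option (Fin n) ⊕ A)), LinearIndepOn ℝ c t →
      Module.finrank ℝ (Submodule.span ℝ (c '' t)) = t.toFinset.card := by
    intro t ht
    have := finrank_span_eq_card (R := ℝ) (b := fun k : t => c k) ht
    rw [Set.toFinset_card, ← this, ← Set.image_eq_range]
  have haffF : ∀ t ⊆ aff, Submodule.span ℝ (c '' t) ≤ affineFun y := by
    intro t ht
    rw [Submodule.span_le]
    rintro _ ⟨k, hk, rfl⟩
    obtain ⟨o, rfl⟩ := ht hk
    exact affineCol_mem y o
  refine ⟨s₂.toFinset, ?_, ?_, ?_, ?_⟩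
  · rw [affineFun, Submodule.span_le]
    rintro _ ⟨o, rfl⟩
    have h := hspan₀ ⟨Sum.inr (Sum.inl o), ⟨o, rfl⟩, rfl⟩
    refine Submodule.span_mono ?_ h
    rintro _ ⟨k, hk, rfl⟩
    obtain ⟨o', rfl⟩ := hs₀ hk
    exact ⟨o', by simpa using h12 (h01 hk), rfl⟩
  · have h : LinearIndepOn ℝ c (s₂.toFinset : Set _) := by rwa [Set.coe_toFinset]
    exact h
  · rw [← hfin s₂ hind₂]
    have : Submodule.span ℝ (c '' s₂) = ⊤ := by
      rw [eq_top_iff]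
      intro f _
      have hf : f = ∑ a, f a • c (Sum.inr (Sum.inr a)) := by
        ext t
        simp [c, allCol, Finset.sum_apply, Pi.single_apply]
      rw [hf]
      exact Submodule.sum_mem _ fun a _ => Submodule.smul_mem _ _ (hspan₂ ⟨_, trivial, rfl⟩)
    rw [this, finrank_top, Module.finrank_fintype_fun_eq_card]
  · have h1 : Module.finrank ℝ (affineFun y * affineFun y : Submodule ℝ (A → ℝ))
        ≤ s₁.toFinset.card := by
      rw [← hfin s₁ hind₁]
      refine Submodule.finrank_mono ((affineFun_mul_self_le y).trans ?_)
      rw [Submodule.span_le]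
      rintro _ (⟨e, rfl⟩ | ⟨o, rfl⟩)
      · exact hspan₁ ⟨Sum.inl e, Or.inl ⟨e, rfl⟩, rfl⟩
      · exact hspan₁ ⟨Sum.inr (Sum.inl o), Or.inr ⟨o, rfl⟩, rfl⟩
    have h2 : (s₁ ∩ aff).toFinset.card ≤ Module.finrank ℝ (affineFun y) := by
      have h := Submodule.finrank_mono (haffF (s₁ ∩ aff) Set.inter_subset_right)
      rw [hfin _ (hind₁.mono Set.inter_subset_left)] at h
      convert h
    have h3 : s₁.toFinset ⊆ s₂.toFinset.toLeft.image Sum.inl ∪ (s₁ ∩ aff).toFinset := by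
      intro k hk
      rw [Set.mem_toFinset] at hk
      rw [Finset.mem_union]
      rcases hs₁ hk with ⟨e, rfl⟩ | h
      · exact Or.inl (Finset.mem_image_of_mem _ (by simpa using h12 hk))
      · exact Or.inr (by simpa using ⟨hk, h⟩)
    have h4 := Finset.card_le_card h3
    have h5 := Finset.card_union_le
      (s₂.toFinset.toLeft.image (Sum.inl : _ → Edge n ⊕ (Option (Fin n) ⊕ A))) (s₁ ∩ aff).toFinset
    have h6 : (s₂.toFinset.toLeft.image
        (Sum.inl : _ → Edge n ⊕ (Option (Fin n) ⊕ A))).card ≤ _ := Finset.card_image_le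
    omega

/-- The affine columns and the point columns that are not selected get the value zero, the others
are distributed according to Lebesgue measure. -/
noncomputable def fakeMeasure {G : Type*} (s : Set G) [DecidablePred (· ∈ s)] (g : G) : Measure ℝ :=
  if g ∈ s then volume else Measure.dirac 0

instance {G : Type*} (s : Set G) [DecidablePred (· ∈ s)] (g : G) :
    SigmaFinite (fakeMeasure s g) := by
  unfold fakeMeasure; split_ifs <;> infer_instance

theorem IsSmoothed.le_smul {φ : ℝ} {μ : Measure ℝ} (h : IsSmoothed φ μ) :
    μ ≤ φ.toNNReal • volume := by
  obtain ⟨f, -, hle, rfl⟩ := h.density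
  calc volume.withDensity f ≤ volume.withDensity fun _ => ENNReal.ofReal φ :=
        withDensity_mono (Filter.Eventually.of_forall hle)
    _ = φ.toNNReal • volume := by rw [withDensity_const]; rfl

/-- Anti-concentration of the quadratic forms with an arbitrary affine shift, jointly with the
fake variables that describe the shift. -/
theorem prod_fake_le [Fintype A] [DecidableEq A] {φ : ℝ} (𝒳 : Edge n → Measure ℝ)
    (h𝒳 : ∀ e, IsSmoothed φ (𝒳 e)) [∀ e, IsProbabilityMeasure (𝒳 e)]
    (s : Finset (Edge n ⊕ (Option (Fin n) ⊕ A)))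
    (hind : LinearIndependent ℝ (fun k : s => allCol y k)) (hcard : s.card = Fintype.card A)
    (r : ℝ) :
    ((Measure.pi 𝒳).prod (Measure.pi (fakeMeasure (s.toRight : Set (Option (Fin n) ⊕ A)))))
      {z | ∀ t, |∑ e, z.1 e * edgeCol y e t + ∑ g, z.2 g * allCol y (Sum.inr g) t| ≤ r}
      ≤ ENNReal.ofReal φ ^ s.toLeft.card * ENNReal.ofReal (2 * r) ^ Fintype.card A := by
  let ν : Edge n ⊕ (Option (Fin n) ⊕ A) → Measure ℝ :=
    Sum.elim 𝒳 (fakeMeasure (s.toRight : Set (Option (Fin n) ⊕ A)))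
  have hνσ : ∀ k, SigmaFinite (ν k) := by
    rintro (e | g)
    · change SigmaFinite (𝒳 e); infer_instance
    · change SigmaFinite (fakeMeasure _ g); infer_instance
  let c : {k // k ∈ s} → ℝ≥0 := fun k => Sum.elim (fun _ => φ.toNNReal) (fun _ => 1) k.1
  have hcardE : Fintype.card A = Fintype.card {k // k ∈ s} := by simp [hcard]
  let ε := Fintype.equivOfCardEq hcardE
  have hc : ∀ k : {k // k ∈ s}, ν k ≤ c k • volume := by
    rintro ⟨e | g, hk⟩
    · exact (h𝒳 e).le_smul
    · change fakeMeasure _ g ≤ (1 : ℝ≥0) • volume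
      rw [one_smul, fakeMeasure, if_pos (by simpa using hk)]
  have hν : ∀ k, k ∉ s → IsProbabilityMeasure (ν k) := by
    rintro (e | g) hk
    · change IsProbabilityMeasure (𝒳 e); infer_instance
    · change IsProbabilityMeasure (fakeMeasure _ g)
      rw [fakeMeasure, if_neg (by simpa using hk)]
      infer_instance
  -- The basis matrix has integer entries and is invertible, so its determinant is a nonzero
  -- integer.
  have hdet : 1 ≤ |(Matrix.of fun j i : {k // k ∈ s} => allCol y i (ε.symm j)).det| := by
    choose m hm using exists_int_allCol y
    set N : Matrix {k // k ∈ s} {k // k ∈ s} ℤ := Matrix.of fun j i => m i (ε.symm j) with hN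
    have hMN : (Matrix.of fun j i : {k // k ∈ s} => allCol y i (ε.symm j))
        = N.map (Int.cast : ℤ → ℝ) := by
      ext j i
      simp [hN, (hm i (ε.symm j)).1]
    have hunit : IsUnit (Matrix.of fun j i : {k // k ∈ s} => allCol y i (ε.symm j)) := by
      rw [← Matrix.linearIndependent_cols_iff_isUnit]
      exact hind.map' (LinearMap.funLeft ℝ ℝ ε.symm)
        (LinearMap.ker_eq_bot.2 (LinearMap.funLeft_injective_of_surjective _ _ _ ε.symm.surjective))
    have h0 : (Matrix.of fun j i : {k // k ∈ s} => allCol y i (ε.symm j)).det ≠ 0 :=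
      ((Matrix.isUnit_iff_isUnit_det _).1 hunit).ne_zero
    rw [hMN, show (N.map (Int.cast : ℤ → ℝ)).det = (N.det : ℝ) from
      (Int.cast_det N).symm] at h0 ⊢
    have h1 : N.det ≠ 0 := by exact_mod_cast h0
    exact_mod_cast Int.one_le_abs h1
  have hmain := pi_forall_abs_sum_le (· ∈ s) ν c hc hν (fun j k => allCol y k (ε.symm j))
    (by convert hdet) r
  have hprod : ∏ k, (c k : ℝ≥0∞) = ENNReal.ofReal φ ^ s.toLeft.card := by
    rw [Finset.prod_coe_sort s fun k =>
      ((Sum.elim (fun _ => φ.toNNReal) (fun _ => 1) k : ℝ≥0) : ℝ≥0∞),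
      ← Finset.toLeft_disjSum_toRight (u := s), Finset.prod_disjSum]
    simp [ENNReal.ofReal]
  have hconst : (∏ k, (c k : ℝ≥0∞)) * ENNReal.ofReal (2 * r) ^ Fintype.card {k // k ∈ s}
      = ENNReal.ofReal φ ^ s.toLeft.card * ENNReal.ofReal (2 * r) ^ Fintype.card A := by
    rw [hprod, hcardE]
  have hmp := measurePreserving_sumPiEquivProdPi ν
  set S : Set ((Edge n → ℝ) × (Option (Fin n) ⊕ A → ℝ)) :=
      {z | ∀ t, |∑ e, z.1 e * edgeCol y e t + ∑ g, z.2 g * allCol y (Sum.inr g) t| ≤ r} with hS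
  have hmeas : MeasurableSet S := by
    rw [hS, Set.ofPred_forall]
    exact MeasurableSet.iInter fun j => measurableSet_le (by fun_prop) measurable_const
  have hpre : MeasurableEquiv.sumPiEquivProdPi (fun _ => ℝ) ⁻¹' S
      = {w | ∀ j : {k // k ∈ s}, |∑ k, allCol y k (ε.symm j) * w k| ≤ r} := by
    ext w
    simp only [hS, Set.mem_preimage, Set.mem_ofPred_eq]
    rw [← ε.symm.forall_congr_right]
    refine forall_congr' fun j => ?_
    rw [Fintype.sum_sum_type fun k => allCol y k (ε.symm j) * w k]
    simp only [mul_comm]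
    rfl
  rw [← hpre, hmp.measure_preimage hmeas.nullMeasurableSet] at hmain
  exact hmain.trans (le_of_eq (by rw [← hconst]; congr!))

end

/-- The weights for which the quadratic forms along `y` are close to an affine function. -/
def nearAffine {n : ℕ} {A : Type*} (y : A → Config n) (η : ℝ) : Set (Weights n) :=
  {X | ∃ f ∈ affineFun y, ∀ t, |∑ e, X e * edgeCol y e t + f t| ≤ η}

/-- The fake variables describing an affine shift have a fibre of large measure. -/
theorem fake_fibre_ge {n : ℕ} {A : Type*} [Fintype A] [DecidableEq A] [Nonempty A]
    (y : A → Config n) (s : Finset (Edge n ⊕ (Option (Fin n) ⊕ A)))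
    (hs : affineFun y ≤ Submodule.span ℝ (affineCol y '' {o | Sum.inr (Sum.inl o) ∈ s}))
    (hcard : s.card = Fintype.card A) {η : ℝ} (hη : 0 < η) {X : Weights n}
    (hX : X ∈ nearAffine y η) :
    ENNReal.ofReal (2 * (η / Fintype.card A)) ^ s.toRight.card ≤
      Measure.pi (fakeMeasure (s.toRight : Set (Option (Fin n) ⊕ A)))
        {w | ∀ t, |∑ e, X e * edgeCol y e t + ∑ g, w g * allCol y (Sum.inr g) t| ≤ 2 * η} := by
  obtain ⟨f, hf, hfX⟩ := hX
  obtain ⟨l, hl, rfl⟩ := (Finsupp.mem_span_image_iff_linearCombination ℝ).1 (hs hf)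
  have hq : (0 : ℝ) < Fintype.card A := by exact_mod_cast Fintype.card_pos
  -- At most `|A|` fake variables are free and all columns are bounded by one, so moving each by at
  -- most `δ` changes every form by at most `η`.
  set δ := η / Fintype.card A with hδ
  have hδ0 : 0 < δ := by positivity
  let w₀ : Option (Fin n) ⊕ A → ℝ := Sum.elim l 0
  have hw₀ : ∀ g, g ∉ s.toRight → w₀ g = 0 := by
    rintro (o | a) hg
    · by_contra h
      exact hg (by simpa using hl (Finsupp.mem_support_iff.2 h))
    · rfl
  have hsum : ∀ t, ∑ g, w₀ g * allCol y (Sum.inr g) t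
      = Finsupp.linearCombination ℝ (affineCol y) l t := by
    intro t
    rw [Fintype.sum_sum_type, Finsupp.linearCombination_apply,
      Finsupp.sum_fintype l (fun i a => a • affineCol y i) fun _ => zero_smul _ _]
    simp [w₀, allCol, Finset.sum_apply]
  let box : Option (Fin n) ⊕ A → Set ℝ := fun g =>
    if g ∈ s.toRight then Set.Icc (w₀ g - δ) (w₀ g + δ) else {0}
  have hbox : Measure.pi (fakeMeasure (s.toRight : Set (Option (Fin n) ⊕ A)))
      (Set.pi Set.univ box) = ENNReal.ofReal (2 * δ) ^ s.toRight.card := by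
    rw [Measure.pi_pi, ← Finset.prod_const, ← Finset.prod_subset (Finset.subset_univ s.toRight)]
    · refine Finset.prod_congr rfl fun g hg => ?_
      simp only [box, fakeMeasure, if_pos hg, if_pos (Finset.mem_coe.2 hg), Real.volume_Icc]
      congr 1
      ring
    · intro g _ hg
      simp only [box, fakeMeasure, if_neg hg, if_neg (fun h => hg (Finset.mem_coe.1 h))]
      simp
  rw [← hbox]
  refine measure_mono fun w hw t => ?_
  have hdiff : |∑ g, (w g - w₀ g) * allCol y (Sum.inr g) t| ≤ η := by
    calc |∑ g, (w g - w₀ g) * allCol y (Sum.inr g) t|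
        ≤ ∑ g, |(w g - w₀ g) * allCol y (Sum.inr g) t| := Finset.abs_sum_le_sum_abs _ _
      _ ≤ ∑ g, if g ∈ s.toRight then δ else 0 := by
        refine Finset.sum_le_sum fun g _ => ?_
        rw [abs_mul]
        have h1 := abs_allCol_le y (Sum.inr g) t
        have h2 := hw g trivial
        by_cases hg : g ∈ s.toRight
        · simp only [box, if_pos hg, Set.mem_Icc] at h2 ⊢
          have h3 : |w g - w₀ g| ≤ δ := abs_le.2 ⟨by linarith, by linarith⟩
          calc |w g - w₀ g| * |allCol y (Sum.inr g) t| ≤ δ * 1 := by gcongr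
            _ = δ := mul_one δ
        · simp only [box, if_neg hg, Set.mem_singleton_iff] at h2 ⊢
          rw [h2, hw₀ g hg]
          simp
      _ = s.toRight.card * δ := by
        rw [Finset.sum_ite_mem, Finset.univ_inter, Finset.sum_const, nsmul_eq_mul]
      _ ≤ Fintype.card A * δ := by
        gcongr
        rw [← hcard, ← Finset.card_toLeft_add_card_toRight (u := s)]
        omega
      _ = η := by rw [hδ]; field_simp
  have hsplit : ∑ g, w g * allCol y (Sum.inr g) t
      = ∑ g, (w g - w₀ g) * allCol y (Sum.inr g) t
        + Finsupp.linearCombination ℝ (affineCol y) l t := by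
    rw [← hsum, ← Finset.sum_add_distrib]
    exact Finset.sum_congr rfl fun g _ => by ring
  rw [hsplit]
  calc _ = |(∑ e, X e * edgeCol y e t + Finsupp.linearCombination ℝ (affineCol y) l t)
        + ∑ g, (w g - w₀ g) * allCol y (Sum.inr g) t| := by congr 1; ring
    _ ≤ η + η := (abs_add_le _ _).trans (add_le_add (hfX t) hdiff)
    _ = 2 * η := by ring

/-- The probability that the quadratic forms along `y` are close to an affine function decays
exponentially in the number of quadratic functions independent modulo the affine functions. -/
theorem measure_nearAffine_le {n : ℕ} {A : Type*} [Fintype A] [Nonempty A] {φ : ℝ} (hφ : 0 < φ)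
    (𝒳 : Edge n → Measure ℝ) (h𝒳 : ∀ e, IsSmoothed φ (𝒳 e)) (y : A → Config n)
    {η : ℝ} (hη : 0 < η) :
    ∃ p : ℕ, Module.finrank ℝ (affineFun y * affineFun y : Submodule ℝ (A → ℝ))
        ≤ p + Module.finrank ℝ (affineFun y) ∧
      Measure.pi 𝒳 (nearAffine y η)
        ≤ ENNReal.ofReal ((4 * η * φ) ^ p * (2 * Fintype.card A) ^ Fintype.card A) := by
  classical
  have : ∀ e, IsProbabilityMeasure (𝒳 e) := fun e => (h𝒳 e).isProb
  obtain ⟨s, hs, hind, hcard, hrank⟩ := exists_column_basis y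
  refine ⟨s.toLeft.card, hrank, ?_⟩
  have hq : (0 : ℝ) < Fintype.card A := by exact_mod_cast Fintype.card_pos
  have hq1 : (1 : ℝ) ≤ Fintype.card A := by exact_mod_cast Fintype.card_pos
  set K : Set ((Edge n → ℝ) × (Option (Fin n) ⊕ A → ℝ)) :=
      {z | ∀ t, |∑ e, z.1 e * edgeCol y e t + ∑ g, z.2 g * allCol y (Sum.inr g) t| ≤ 2 * η} with hK
  have hmeas : MeasurableSet K := by
    rw [hK, Set.ofPred_forall]
    exact MeasurableSet.iInter fun j => measurableSet_le (by fun_prop) measurable_const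
  have h1 := prod_fake_le y 𝒳 h𝒳 s hind hcard (2 * η)
  rw [← hK, Measure.prod_apply hmeas] at h1
  -- Markov's inequality for the fibre measure: every `X` in the event has a fibre of measure at
  -- least `(2η/|A|)^{|s.toRight|}`, while the joint measure is at most `φ^p (4η)^{|A|}`. The
  -- quotient leaves `(4ηφ)^p` times a power of `2|A|`. The union over all affine shifts is thus
  -- paid for without a net.
  have h2 := mul_meas_ge_le_lintegral (μ := Measure.pi 𝒳)
    (measurable_measure_prodMk_left
      (ν := Measure.pi (fakeMeasure (s.toRight : Set (Option (Fin n) ⊕ A)))) hmeas)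
    (ENNReal.ofReal (2 * (η / Fintype.card A)) ^ s.toRight.card)
  have h3 : Measure.pi 𝒳 (nearAffine y η) ≤ _ :=
    measure_mono fun X hX => fake_fibre_ge y s hs hcard hη hX
  have h4 := (mul_le_mul' le_rfl h3).trans (h2.trans h1)
  rw [← ENNReal.ofReal_pow (by positivity), ← ENNReal.ofReal_pow hφ.le,
    ← ENNReal.ofReal_pow (by positivity), ← ENNReal.ofReal_mul (by positivity), mul_comm] at h4
  have hpos : 0 < (2 * (η / Fintype.card A)) ^ s.toRight.card := by positivity
  have h5 := (ENNReal.le_div_iff_mul_le (Or.inl (ENNReal.ofReal_pos.2 hpos).ne')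
    (Or.inl ENNReal.ofReal_ne_top)).2 h4
  rw [← ENNReal.ofReal_div_of_pos hpos] at h5
  refine h5.trans (ENNReal.ofReal_le_ofReal ?_)
  rw [div_le_iff₀ hpos]
  have hle : s.toRight.card ≤ Fintype.card A := by
    rw [← hcard, ← Finset.card_toLeft_add_card_toRight (u := s)]
    omega
  have hsplit : Fintype.card A = s.toLeft.card + s.toRight.card := by
    rw [← hcard, Finset.card_toLeft_add_card_toRight]
  calc φ ^ s.toLeft.card * (2 * (2 * η)) ^ Fintype.card A
      = (4 * η * φ) ^ s.toLeft.card
        * ((2 * (Fintype.card A : ℝ)) ^ s.toRight.card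
          * (2 * (η / Fintype.card A)) ^ s.toRight.card) := by
        rw [← mul_pow, show 2 * (Fintype.card A : ℝ) * (2 * (η / Fintype.card A)) = 4 * η by
          field_simp; ring, hsplit, pow_add, mul_pow (4 * η)]
        ring
    _ ≤ (4 * η * φ) ^ s.toLeft.card
        * ((2 * (Fintype.card A : ℝ)) ^ Fintype.card A
          * (2 * (η / Fintype.card A)) ^ s.toRight.card) := by
        gcongr
        linarith
    _ = _ := by ring

/-! ### Forgetting the nodes that never move -/

/-- The sequence in which every node that never moves is put on the side `1`. -/
noncomputable def normalize {n : ℕ} {A : Type*} (x : A → Config n) : A → Config n := by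
  classical
  exact fun t u => if ∀ s s', x s u = x s' u then 1 else x t u

section

variable {n : ℕ} {A : Type*} (x : A → Config n)

theorem normalize_of_const {u : Fin n} (h : ∀ s s', x s u = x s' u) (t : A) :
    normalize x t u = 1 := by
  simp only [normalize]
  exact if_pos h

theorem normalize_of_not_const {u : Fin n} (h : ¬ ∀ s s', x s u = x s' u) (t : A) :
    normalize x t u = x t u := by
  simp only [normalize]
  exact if_neg h

theorem normalize_eq_one {u : Fin n} (h : ∀ s s', normalize x s u = normalize x s' u) (t : A) :
    normalize x t u = 1 := by
  by_cases hu : ∀ s s', x s u = x s' u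
  · exact normalize_of_const x hu t
  · exfalso
    refine hu fun s s' => ?_
    rw [← normalize_of_not_const x hu s, ← normalize_of_not_const x hu s']
    exact h s s'

theorem normalize_ne {u : Fin n} {s t : A} (h : normalize x s u ≠ normalize x t u) :
    x s u ≠ x t u := by
  by_cases hu : ∀ s s', x s u = x s' u
  · rw [normalize_of_const x hu, normalize_of_const x hu] at h
    exact absurd rfl h
  · rwa [normalize_of_not_const x hu, normalize_of_not_const x hu] at h

theorem const_mem_affineFun (c : ℝ) : (fun _ => c) ∈ affineFun x := by
  have := (affineFun x).smul_mem c (one_mem_affineFun x)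
  convert this using 1
  ext
  simp

theorem affineFun_normalize : affineFun (normalize x) = affineFun x := by
  apply le_antisymm
  · rw [affineFun, Submodule.span_le]
    rintro _ ⟨o, rfl⟩
    rcases o with _ | u
    · exact one_mem_affineFun x
    · by_cases hu : ∀ s s', x s u = x s' u
      · have : affineCol (normalize x) (some u) = fun _ => 1 := by
          ext t
          simp [affineCol, normalize_of_const x hu]
        rw [this]
        exact const_mem_affineFun x 1
      · have : affineCol (normalize x) (some u) = affineCol x (some u) := by
          ext t
          simp [affineCol, normalize_of_not_const x hu]
        rw [this]
        exact affineCol_mem x _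
  · rw [affineFun, Submodule.span_le]
    rintro _ ⟨o, rfl⟩
    rcases o with _ | u
    · exact one_mem_affineFun _
    · by_cases hu : ∀ s s', x s u = x s' u
      · rcases isEmpty_or_nonempty A with hA | ⟨⟨t₀⟩⟩
        · rw [Subsingleton.elim (affineCol x (some u)) 0]
          exact Submodule.zero_mem _
        · have : affineCol x (some u) = fun _ => ((x t₀ u : ℤ) : ℝ) := by
            ext t
            simp [affineCol, hu t t₀]
          rw [this]
          exact const_mem_affineFun _ _
      · have : affineCol x (some u) = affineCol (normalize x) (some u) := by
          ext t
          simp [affineCol, normalize_of_not_const x hu]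
        rw [this]
        exact affineCol_mem _ _

theorem edgeCol_mem_of_const {e : Edge n}
    (h : (∀ s s', x s e.1.1 = x s' e.1.1) ∨ ∀ s s', x s e.1.2 = x s' e.1.2) :
    edgeCol x e ∈ affineFun x := by
  rcases isEmpty_or_nonempty A with hA | ⟨⟨t₀⟩⟩
  · rw [Subsingleton.elim (edgeCol x e) 0]
    exact Submodule.zero_mem _
  rcases h with h | h
  · convert (affineFun x).smul_mem ((x t₀ e.1.1 : ℤ) : ℝ) (coord_mem_affineFun x e.1.2) using 1
    ext t
    simp [edgeCol, h t t₀]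
  · convert (affineFun x).smul_mem ((x t₀ e.1.2 : ℤ) : ℝ) (coord_mem_affineFun x e.1.1) using 1
    ext t
    simp [edgeCol, h t t₀, mul_comm]

/-- An edge with an endpoint that never moves has a column that is a multiple of one coordinate,
hence affine, both before and after normalization. All other edge columns are unchanged. -/
theorem edgeCol_sub_normalize_mem (e : Edge n) :
    edgeCol x e - edgeCol (normalize x) e ∈ affineFun x := by
  by_cases h : (∀ s s', x s e.1.1 = x s' e.1.1) ∨ ∀ s s', x s e.1.2 = x s' e.1.2
  · refine Submodule.sub_mem _ (edgeCol_mem_of_const x h) ?_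
    rw [← affineFun_normalize]
    refine edgeCol_mem_of_const _ (h.imp ?_ ?_) <;>
    · intro h s s'
      rw [normalize_of_const x h, normalize_of_const x h]
  · rw [not_or] at h
    have : edgeCol x e - edgeCol (normalize x) e = 0 := by
      ext t
      simp [edgeCol, normalize_of_not_const x h.1, normalize_of_not_const x h.2]
    rw [this]
    exact Submodule.zero_mem _

theorem nearAffine_subset_normalize (η : ℝ) : nearAffine x η ⊆ nearAffine (normalize x) η := by
  rintro X ⟨f, hf, h⟩
  refine ⟨f + ∑ e, X e • (edgeCol x e - edgeCol (normalize x) e), ?_, fun t => ?_⟩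
  · rw [affineFun_normalize]
    exact Submodule.add_mem _ hf (Submodule.sum_mem _ fun e _ =>
      Submodule.smul_mem _ _ (edgeCol_sub_normalize_mem x e))
  · convert h t using 2
    simp only [Pi.add_apply, Finset.sum_apply, Pi.smul_apply, Pi.sub_apply, smul_eq_mul, mul_sub,
      Finset.sum_sub_distrib]
    ring

/-- The product of two signs is `1 - 2 · 1{signs differ}`. -/
theorem sum_edgeCol_eq (X : Weights n) (t : A) :
    ∑ e, X e * edgeCol x e t = ∑ e, X e - 2 * obj X (x t) := by
  rw [obj, Finset.mul_sum, ← Finset.sum_sub_distrib]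
  refine Finset.sum_congr rfl fun e _ => ?_
  rcases Int.units_eq_one_or (x t e.1.1) with h1 | h1 <;>
  rcases Int.units_eq_one_or (x t e.1.2) with h2 | h2 <;>
  simp [edgeCol, h1, h2] <;> ring

theorem mem_nearAffine_of_obj {X : Weights n} {c ε : ℝ}
    (h : ∀ t, c ≤ obj X (x t) ∧ obj X (x t) ≤ c + ε) : X ∈ nearAffine x (2 * ε) := by
  refine ⟨fun _ => 2 * c - ∑ e, X e, const_mem_affineFun x _, fun t => ?_⟩
  rw [sum_edgeCol_eq, abs_le]
  obtain ⟨h1, h2⟩ := h t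
  constructor <;> linarith

end

/-! ### Counting move patterns and the union bound -/

/-- Sequences of configurations, consecutive ones differing in at most two nodes, with all the
nodes that never move on the side `1`. -/
def normalPaths (n q : ℕ) : Set (Fin q → Config n) :=
  {y | (∀ (t : ℕ) (h : t + 1 < q), hammingDist (y ⟨t, by omega⟩) (y ⟨t + 1, h⟩) ≤ 2) ∧
    ∀ u, (∀ s s', y s u = y s' u) → ∀ t, y t u = 1}

theorem exists_cover_of_hammingDist_le {n : ℕ} [Nonempty (Fin n)] {γ γ' : Config n}
    (h : hammingDist γ γ' ≤ 2) : ∃ p : Fin n × Fin n, ∀ v, γ v ≠ γ' v → v = p.1 ∨ v = p.2 := by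
  classical
  unfold hammingDist at h
  obtain ⟨v₀⟩ := ‹Nonempty (Fin n)›
  have hmem : ∀ v, γ v ≠ γ' v → v ∈ (Finset.univ.filter fun i => γ i ≠ γ' i) := by simp
  set s := Finset.univ.filter fun i => γ i ≠ γ' i
  have h3 : s.card = 0 ∨ s.card = 1 ∨ s.card = 2 := by omega
  rcases h3 with h3 | h3 | h3
  · rw [Finset.card_eq_zero] at h3
    exact ⟨(v₀, v₀), fun v hv => by simpa [h3] using hmem v hv⟩
  · obtain ⟨a, ha⟩ := Finset.card_eq_one.1 h3
    exact ⟨(a, a), fun v hv => by simpa [ha] using hmem v hv⟩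
  · obtain ⟨a, b, -, hab⟩ := Finset.card_eq_two.1 h3
    exact ⟨(a, b), fun v hv => by simpa [hab] using hmem v hv⟩

/-- Each time is encoded by a pair of nodes covering the move (`n²` choices), the signs of the pair
at the start (4) and right after the move (4). A node in none of the pairs never moves and so has
sign `1`, whence the code determines the path. -/
theorem card_normalPaths_le {n q : ℕ} (hn : 1 ≤ n) :
    (normalPaths n q).ncard ≤ (16 * n ^ 2) ^ q := by
  classical
  have : Nonempty (Fin n) := ⟨⟨0, hn⟩⟩
  rcases Nat.eq_zero_or_pos q with rfl | hq
  · refine (Set.ncard_le_one_of_subsingleton _).trans (by simp)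
  have hp : ∀ y : normalPaths n q, ∀ t : Fin q, ∃ p : Fin n × Fin n, ∀ h : t.1 + 1 < q,
      ∀ v, y.1 t v ≠ y.1 ⟨t.1 + 1, h⟩ v → v = p.1 ∨ v = p.2 := by
    intro y t
    by_cases h : t.1 + 1 < q
    · obtain ⟨p, hp⟩ := exists_cover_of_hammingDist_le (y.2.1 t.1 h)
      exact ⟨p, fun _ => hp⟩
    · exact ⟨Classical.arbitrary _, fun h' => absurd h' h⟩
  choose p hp using hp
  let next : Fin q → Fin q := fun t => if h : t.1 + 1 < q then ⟨t.1 + 1, h⟩ else t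
  let code : normalPaths n q → Fin q → (Fin n × Fin n) × (ℤˣ × ℤˣ) × (ℤˣ × ℤˣ) := fun y t =>
    (p y t, (y.1 ⟨0, hq⟩ (p y t).1, y.1 ⟨0, hq⟩ (p y t).2),
      (y.1 (next t) (p y t).1, y.1 (next t) (p y t).2))
  have hinj : Function.Injective code := by
    intro y y' hyy
    have hc : ∀ t, code y t = code y' t := fun t => congrFun hyy t
    have hpp : ∀ t, p y t = p y' t := fun t => congrArg Prod.fst (hc t)
    have h0 : ∀ t, y.1 ⟨0, hq⟩ (p y t).1 = y'.1 ⟨0, hq⟩ (p y t).1 ∧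
        y.1 ⟨0, hq⟩ (p y t).2 = y'.1 ⟨0, hq⟩ (p y t).2 := fun t => by
      have h := congrArg (fun c => c.2.1) (hc t)
      simp only [code, ← hpp t, Prod.mk.injEq] at h
      exact h
    have h1 : ∀ t, y.1 (next t) (p y t).1 = y'.1 (next t) (p y t).1 ∧
        y.1 (next t) (p y t).2 = y'.1 (next t) (p y t).2 := fun t => by
      have h := congrArg (fun c => c.2.2) (hc t)
      simp only [code, ← hpp t, Prod.mk.injEq] at h
      exact h
    -- a node which is not in the code does not move
    have hconst : ∀ (w : normalPaths n q) (v : Fin n), (∀ t, v ≠ (p w t).1 ∧ v ≠ (p w t).2) →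
        ∀ s, w.1 s v = 1 := by
      intro w v hv
      have hz : ∀ (t : ℕ) (h : t < q), w.1 ⟨t, h⟩ v = w.1 ⟨0, hq⟩ v := by
        intro t
        induction t with
        | zero => intro _; rfl
        | succ t ih =>
          intro h
          rw [← ih (by omega)]
          by_contra hne
          rcases hp w ⟨t, by omega⟩ h v (Ne.symm hne) with h' | h'
          · exact (hv _).1 h'
          · exact (hv _).2 h'
      exact w.2.2 v fun s s' => (hz s.1 s.2).trans (hz s'.1 s'.2).symm
    have hstart : ∀ v, y.1 ⟨0, hq⟩ v = y'.1 ⟨0, hq⟩ v := by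
      intro v
      by_cases hv : ∀ t, v ≠ (p y t).1 ∧ v ≠ (p y t).2
      · rw [hconst y v hv, hconst y' v fun t => hpp t ▸ hv t]
      · push Not at hv
        obtain ⟨t, ht⟩ := hv
        by_cases hv1 : v = (p y t).1
        · rw [hv1]; exact (h0 t).1
        · rw [ht hv1]; exact (h0 t).2
    have hall : ∀ (t : ℕ) (h : t < q), ∀ v, y.1 ⟨t, h⟩ v = y'.1 ⟨t, h⟩ v := by
      intro t
      induction t with
      | zero => intro _; exact hstart
      | succ t ih =>
        intro h v
        have hnext : next ⟨t, by omega⟩ = ⟨t + 1, h⟩ := by simp [next, h]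
        have h1' := h1 ⟨t, by omega⟩
        rw [hnext] at h1'
        by_cases hv : v = (p y ⟨t, by omega⟩).1 ∨ v = (p y ⟨t, by omega⟩).2
        · rcases hv with hv | hv
          · rw [hv]; exact h1'.1
          · rw [hv]; exact h1'.2
        · have e1 : y.1 ⟨t, by omega⟩ v = y.1 ⟨t + 1, h⟩ v := by
            by_contra hne
            exact hv (hp y ⟨t, by omega⟩ h v hne)
          have e2 : y'.1 ⟨t, by omega⟩ v = y'.1 ⟨t + 1, h⟩ v := by
            by_contra hne
            exact hv (hpp ⟨t, by omega⟩ ▸ hp y' ⟨t, by omega⟩ h v hne)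
          rw [← e1, ← e2]
          exact ih (by omega) v
    exact Subtype.ext (funext fun t => funext fun v => hall t.1 t.2 v)
  have hcard := Nat.card_le_card_of_injective code hinj
  rw [Nat.card_coe_set_eq] at hcard
  refine hcard.trans (le_of_eq ?_)
  simp only [Nat.card_eq_fintype_card, Fintype.card_fun, Fintype.card_prod, Fintype.card_fin,
    Fintype.card_units_int]
  congr 1
  ring

/-- The weights that admit a sequence of `N` configurations, each improving on the previous one by
flipping at most two nodes, with total improvement at most `ε`. -/
def slowWeights (n N : ℕ) (ε : ℝ) : Set (Weights n) :=
  {X | ∃ z : ℕ → Config n, (∀ t, t + 1 < N → hammingDist (z t) (z (t + 1)) ≤ 2 ∧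
    obj X (z t) < obj X (z (t + 1))) ∧ obj X (z (N - 1)) ≤ obj X (z 0) + ε}

/-- Strict improvement makes the configurations distinct, so a block of large rank exists. On it the
cut weight stays within `ε`, so the quadratic form, which scales it by `-2`, stays within `2ε` of a
constant; normalization preserves this up to an affine function. -/
theorem slowWeights_subset {n K : ℕ} (hK : 2 * (n + 1) < 2 ^ K) (ε : ℝ) :
    slowWeights n (2 ^ K) ε ⊆ ⋃ j ∈ Finset.Icc 1 K, ⋃ y ∈ {y ∈ normalPaths n (2 ^ j) |
      2 ^ j + 10 * K * Module.finrank ℝ (affineFun y) ≤ 10 * K *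
        Module.finrank ℝ (affineFun y * affineFun y : Submodule ℝ (Fin (2 ^ j) → ℝ))},
      nearAffine y (2 * ε) := by
  rintro X ⟨z, hz, hε⟩
  have hlt : ∀ t s, s < t → t < 2 ^ K → obj X (z s) < obj X (z t) := by
    intro t
    induction t with
    | zero => intro s hs; omega
    | succ t ih =>
      intro s hs ht
      rcases Nat.lt_succ_iff_lt_or_eq.1 hs with h | rfl
      · exact (ih s h (by omega)).trans (hz t ht).2
      · exact (hz s ht).2
  have hle : ∀ t s, s ≤ t → t < 2 ^ K → obj X (z s) ≤ obj X (z t) := by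
    intro t s hs ht
    rcases hs.lt_or_eq with h | rfl
    · exact (hlt t s h ht).le
    · exact le_rfl
  have hinj : Set.InjOn z (Set.Iio (2 ^ K)) := by
    intro s hs t ht hst
    rcases lt_trichotomy s t with h | h | h
    · exact absurd (congrArg (obj X) hst) (hlt t s h ht).ne
    · exact h
    · exact absurd (congrArg (obj X) hst) (hlt s t h hs).ne'
  obtain ⟨j, a, hj1, hjK, ha, hrank⟩ := exists_block_finrank_mul z hinj hK
  simp only [Set.mem_iUnion]
  refine ⟨j, Finset.mem_Icc.2 ⟨hj1, hjK⟩, normalize (block z a (2 ^ j)), ⟨⟨?_, ?_⟩, ?_⟩, ?_⟩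
  · intro t ht
    refine le_trans ?_ (hz (a + t) (by omega)).1
    unfold hammingDist
    refine Finset.card_le_card fun u hu => ?_
    rw [Finset.mem_filter] at hu ⊢
    exact ⟨hu.1, normalize_ne (block z a (2 ^ j)) hu.2⟩
  · exact fun u hu t => normalize_eq_one _ hu t
  · rwa [affineFun_normalize]
  · refine nearAffine_subset_normalize _ _ (mem_nearAffine_of_obj _ (c := obj X (z 0)) fun t => ?_)
    have h1 : a + t.1 < 2 ^ K := by omega
    exact ⟨hle _ _ (Nat.zero_le _) h1, (hle (2 ^ K - 1) (a + t.1) (by omega) (by omega)).trans hε⟩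

/-- The probability that a long sequence of improvements has a small total improvement. -/
theorem measure_slowWeights_le {n K : ℕ} (hn : 1 ≤ n) (hK : 2 * (n + 1) < 2 ^ K) {φ : ℝ}
    (hφ : 0 < φ) (𝒳 : Edge n → Measure ℝ) (h𝒳 : ∀ e, IsSmoothed φ (𝒳 e)) {ε : ℝ} (hε : 0 < ε) :
    Measure.pi 𝒳 (slowWeights n (2 ^ K) ε)
      ≤ ENNReal.ofReal (K * ((32 * n ^ 2 * 2 ^ K : ℝ) ^ (10 * K) * (8 * ε * φ))) := by
  have : ∀ e, IsProbabilityMeasure (𝒳 e) := fun e => (h𝒳 e).isProb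
  have hK0 : 1 ≤ K := by
    rcases Nat.eq_zero_or_pos K with rfl | h
    · omega
    · exact h
  have hK1 : (1 : ℝ) ≤ K := by exact_mod_cast hK0
  have hn1 : (1 : ℝ) ≤ n := by exact_mod_cast hn
  set R : ℝ := 32 * n ^ 2 * 2 ^ K with hR
  have hR1 : 1 ≤ R := by
    have h1 : (1 : ℝ) ≤ 2 ^ K := one_le_pow₀ (by norm_num)
    have h2 : (1 : ℝ) ≤ n ^ 2 := one_le_pow₀ hn1
    nlinarith
  set δ := 8 * ε * φ with hδ
  have hδ0 : 0 < δ := by positivity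
  set B := R ^ (10 * K) * δ with hB
  have hB0 : 0 < B := by positivity
  -- For `B ≥ 1` the claim is trivial; otherwise `B ^ p ≤ B`, which lets the unknown rank `p ≥ 1` be
  -- replaced by one.
  rcases le_or_gt 1 B with hB1 | hB1
  · refine prob_le_one.trans ?_
    rw [← ENNReal.ofReal_one]
    exact ENNReal.ofReal_le_ofReal (by nlinarith)
  have hpath : ∀ j ∈ Finset.Icc 1 K, ∀ y : Fin (2 ^ j) → Config n,
      2 ^ j + 10 * K * Module.finrank ℝ (affineFun y) ≤ 10 * K *
        Module.finrank ℝ (affineFun y * affineFun y : Submodule ℝ (Fin (2 ^ j) → ℝ)) →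
      Measure.pi 𝒳 (nearAffine y (2 * ε)) ≤ ENNReal.ofReal (B / (16 * n ^ 2) ^ 2 ^ j) := by
    intro j hj y hy
    rw [Finset.mem_Icc] at hj
    have : Nonempty (Fin (2 ^ j)) := ⟨⟨0, by positivity⟩⟩
    obtain ⟨p, hp, hle⟩ := measure_nearAffine_le hφ 𝒳 h𝒳 y (η := 2 * ε) (by positivity)
    have hqp : 2 ^ j ≤ 10 * K * p := by
      have := Nat.mul_le_mul_left (10 * K) hp
      rw [mul_add] at this
      omega
    have hp0 : p ≠ 0 := by
      rintro rfl
      have : 0 < 2 ^ j := by positivity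
      omega
    refine hle.trans (ENNReal.ofReal_le_ofReal ?_)
    rw [le_div_iff₀ (by positivity), Fintype.card_fin]
    have hpow : (2 : ℝ) ^ j ≤ 2 ^ K := pow_le_pow_right₀ (by norm_num) hj.2
    calc (4 * (2 * ε) * φ) ^ p * (2 * ((2 ^ j : ℕ) : ℝ)) ^ 2 ^ j * (16 * (n : ℝ) ^ 2) ^ 2 ^ j
        = δ ^ p * (32 * n ^ 2 * 2 ^ j) ^ 2 ^ j := by
          rw [mul_assoc, ← mul_pow, hδ]
          push_cast
          ring_nf
      _ ≤ δ ^ p * R ^ 2 ^ j := by rw [hR]; gcongr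
      -- The rank bound `2 ^ j ≤ 10 K p` turns the entropy of the paths into a `p`-th power, to be
      -- absorbed by `δ ^ p`.
      _ ≤ δ ^ p * R ^ (10 * K * p) := by gcongr
      _ = B ^ p := by
          rw [hB, mul_pow (R ^ (10 * K)), ← pow_mul, mul_comm]
      _ ≤ B ^ 1 := pow_le_pow_of_le_one hB0.le hB1.le (Nat.one_le_iff_ne_zero.2 hp0)
      _ = B := pow_one B
  have hlevel : ∀ j ∈ Finset.Icc 1 K, Measure.pi 𝒳 (⋃ y ∈ {y ∈ normalPaths n (2 ^ j) |
      2 ^ j + 10 * K * Module.finrank ℝ (affineFun y) ≤ 10 * K *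
        Module.finrank ℝ (affineFun y * affineFun y : Submodule ℝ (Fin (2 ^ j) → ℝ))},
      nearAffine y (2 * ε)) ≤ ENNReal.ofReal B := by
    intro j hj
    set S := {y ∈ normalPaths n (2 ^ j) |
      2 ^ j + 10 * K * Module.finrank ℝ (affineFun y) ≤ 10 * K *
        Module.finrank ℝ (affineFun y * affineFun y : Submodule ℝ (Fin (2 ^ j) → ℝ))} with hS
    have hfin : S.Finite := Set.toFinite S
    have hcard : hfin.toFinset.card ≤ (16 * n ^ 2) ^ 2 ^ j := by
      rw [← Set.ncard_eq_toFinset_card S hfin]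
      exact (Set.ncard_le_ncard (Set.sep_subset _ _) (Set.toFinite _)).trans
        (card_normalPaths_le hn)
    have hU : (⋃ y ∈ S, nearAffine y (2 * ε)) = ⋃ y ∈ hfin.toFinset, nearAffine y (2 * ε) := by
      simp
    rw [hU]
    refine (measure_biUnion_finset_le _ _).trans ?_
    refine (Finset.sum_le_card_nsmul _ _ (ENNReal.ofReal (B / (16 * n ^ 2) ^ 2 ^ j))
      fun y hy => hpath j hj y ?_).trans ?_
    · exact ((Set.Finite.mem_toFinset hfin).1 hy).2
    · rw [← ENNReal.ofReal_nsmul, nsmul_eq_mul]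
      refine ENNReal.ofReal_le_ofReal ?_
      have hc : (hfin.toFinset.card : ℝ) ≤ (16 * n ^ 2) ^ 2 ^ j := by exact_mod_cast hcard
      calc (hfin.toFinset.card : ℝ) * (B / (16 * n ^ 2) ^ 2 ^ j)
          ≤ (16 * n ^ 2) ^ 2 ^ j * (B / (16 * n ^ 2) ^ 2 ^ j) := by gcongr
        _ = B := by field_simp
  refine (measure_mono (slowWeights_subset hK ε)).trans ((measure_biUnion_finset_le _ _).trans ?_)
  refine (Finset.sum_le_card_nsmul _ _ _ hlevel).trans ?_
  rw [← ENNReal.ofReal_nsmul, nsmul_eq_mul, Nat.card_Icc]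
  simp

/-! ### From slow windows to the expected number of steps -/

theorem abs_obj_le {n : ℕ} {X : Weights n} (hX : ∀ e, |X e| ≤ 1) (γ : Config n) :
    |obj X γ| ≤ (n : ℝ) ^ 2 := by
  have hcard : Fintype.card (Edge n) ≤ n ^ 2 := by
    refine (Fintype.card_subtype_le _).trans ?_
    simp [sq]
  calc |obj X γ| ≤ ∑ e : Edge n, |X e * (if γ e.1.1 ≠ γ e.1.2 then 1 else 0)| :=
        Finset.abs_sum_le_sum_abs _ _
    _ ≤ ∑ _e : Edge n, (1 : ℝ) := by
        refine Finset.sum_le_sum fun e _ => ?_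
        have := hX e
        split_ifs
        · simpa using this
        · simp
    _ ≤ (n : ℝ) ^ 2 := by
        simp only [Finset.sum_const, Finset.card_univ, nsmul_eq_mul, mul_one]
        exact_mod_cast hcard

section

variable {n : ℕ} {X : Weights n} {step : Config n → Config n → Prop} {opt : Config n → Prop}
  {γ : ℕ → Config n}

theorem numSteps_le_of_exists {m : ℕ} (h : ∃ k ≤ m, opt (γ k)) : numSteps opt γ ≤ m := by
  obtain ⟨k, hk, hopt⟩ := h
  exact (iInf_le (fun k : {k : ℕ // opt (γ k)} => (k.1 : ℕ∞)) ⟨k, hopt⟩).trans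
    (by exact_mod_cast hk)

/-- The objective increases strictly, so no configuration recurs, and there are only `2 ^ n` of
them. -/
theorem numSteps_le_two_pow (hstep : ∀ γ γ', step γ γ' → obj X γ < obj X γ')
    (hγ : IsExecution step opt γ) : numSteps opt γ ≤ (2 ^ n : ℕ) := by
  refine numSteps_le_of_exists ?_
  by_contra! hcon
  have hlt : ∀ t s, s < t → t ≤ 2 ^ n → obj X (γ s) < obj X (γ t) := by
    intro t
    induction t with
    | zero => intro s hs; omega
    | succ t ih =>
      intro s hs ht
      have h1 := hstep _ _ ((hγ t).1 (hcon t (by omega)))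
      rcases Nat.lt_succ_iff_lt_or_eq.1 hs with h | rfl
      · exact (ih s h (by omega)).trans h1
      · exact h1
  have hinj : Function.Injective fun t : Fin (2 ^ n + 1) => γ t := by
    intro s t hst
    rcases lt_trichotomy s t with h | h | h
    · exact absurd (congrArg (obj X) hst) (hlt t s h (by omega)).ne
    · exact h
    · exact absurd (congrArg (obj X) hst) (hlt s t h (by omega)).ne'
  have := Fintype.card_le_of_injective _ hinj
  simp [Fintype.card_units_int] at this

/-- A run of `N * M` steps splits into `M` windows, each gaining more than `ε`: the `N`
configurations of a window account for `N - 1` steps, and the step into the next window only adds to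
the gain. The objective ranges over an interval of length at most `2 n²`, so this is impossible once
`M ε > 2 n²`. -/
theorem numSteps_le_of_notMem_slowWeights (hX : ∀ e, |X e| ≤ 1)
    (hstep : ∀ γ γ', step γ γ' → hammingDist γ γ' ≤ 2 ∧ obj X γ < obj X γ')
    (hγ : IsExecution step opt γ) {N M : ℕ} (hN : 1 ≤ N) {ε : ℝ}
    (hslow : X ∉ slowWeights n N ε) (hM : 2 * (n : ℝ) ^ 2 < M * ε) :
    numSteps opt γ ≤ (N * M : ℕ) := by
  refine numSteps_le_of_exists ?_
  by_contra! hcon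
  have hs : ∀ t ≤ N * M, hammingDist (γ t) (γ (t + 1)) ≤ 2 ∧ obj X (γ t) < obj X (γ (t + 1)) :=
    fun t ht => hstep _ _ ((hγ t).1 (hcon t ht))
  have hprog : ∀ i ≤ M, obj X (γ 0) + i * ε ≤ obj X (γ (N * i)) := by
    intro i
    induction i with
    | zero => intro _; simp
    | succ i ih =>
      intro hi
      have hmul : N * (i + 1) ≤ N * M := Nat.mul_le_mul_left N hi
      rw [mul_add, mul_one] at hmul ⊢
      have h1 := ih (by omega)
      have h2 : obj X (γ (N * i)) + ε < obj X (γ (N * i + (N - 1))) := by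
        by_contra! hle
        exact hslow ⟨fun t => γ (N * i + t), fun t ht => hs (N * i + t) (by omega), hle⟩
      have h3 := (hs (N * i + (N - 1)) (by omega)).2
      rw [show N * i + (N - 1) + 1 = N * i + N by omega] at h3
      push_cast
      linarith
  have h1 := hprog M le_rfl
  have h2 := abs_le.1 (abs_obj_le hX (γ 0))
  have h3 := abs_le.1 (abs_obj_le hX (γ (N * M)))
  linarith

end

/-- A density bounded by `φ` has mass at most `2φ` on an interval of length two. This lets the part
of the final bound that carries no factor `φ` be absorbed. -/
theorem half_le_of_isSmoothed {φ : ℝ} {μ : Measure ℝ} (h : IsSmoothed φ μ) : 1 / 2 ≤ φ := by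
  have := h.isProb
  have h1 : μ (Set.Icc (-1) 1) = 1 := by
    rw [← prob_compl_eq_zero_iff measurableSet_Icc]
    exact h.support
  have h2 := h.le_smul (Set.Icc (-1) 1)
  rw [h1, Measure.smul_apply, Real.volume_Icc, ENNReal.smul_def, smul_eq_mul] at h2
  have h3 : (1 : ℝ≥0∞) ≤ ENNReal.ofReal (φ.toNNReal * 2) := by
    rw [ENNReal.ofReal_mul (by positivity), ENNReal.ofReal_coe_nnreal]
    convert h2 using 3
    norm_num
  rw [← ENNReal.ofReal_one, ENNReal.ofReal_le_ofReal_iff (by positivity)] at h3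
  rcases le_or_gt 0 φ with hφ | hφ
  · rw [Real.coe_toNNReal φ hφ] at h3
    linarith
  · rw [Real.toNNReal_of_nonpos hφ.le] at h3
    norm_num at h3

theorem ae_abs_le_one {n : ℕ} {φ : ℝ} {𝒳 : Edge n → Measure ℝ} (h𝒳 : ∀ e, IsSmoothed φ (𝒳 e)) :
    ∀ᵐ X ∂(Measure.pi 𝒳), ∀ e, |X e| ≤ 1 := by
  have : ∀ e, IsProbabilityMeasure (𝒳 e) := fun e => (h𝒳 e).isProb
  rw [ae_all_iff]
  intro e
  have h1 : ∀ᵐ x ∂(𝒳 e), |x| ≤ 1 := by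
    have := (h𝒳 e).support
    rw [ae_iff]
    convert this using 2
    ext x
    simp [abs_le]
  exact (Measure.tendsto_eval_ae_ae (μ := 𝒳) (i := e)).eventually h1

/-- The expected number of steps of a local search with steps flipping at most two nodes. -/
theorem lintegral_numSteps_le_sum {n K : ℕ} (hn : 1 ≤ n) (hK : 2 * (n + 1) < 2 ^ K) {φ : ℝ}
    (hφ : 0 < φ) (𝒳 : Edge n → Measure ℝ) (h𝒳 : ∀ e, IsSmoothed φ (𝒳 e))
    {Ω : Type*} [MeasurableSpace Ω] (P : Measure Ω) [IsProbabilityMeasure P]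
    (X : Ω → Weights n) (hX : HasLaw X (Measure.pi 𝒳) P) (Γ : Ω → ℕ → Config n)
    (step : Weights n → Config n → Config n → Prop) (opt : Weights n → Config n → Prop)
    (hstep : ∀ X γ γ', step X γ γ' → hammingDist γ γ' ≤ 2 ∧ obj X γ < obj X γ')
    (hΓ : ∀ᵐ ω ∂P, IsExecution (step (X ω)) (opt (X ω)) (Γ ω)) :
    ∫⁻ ω, (numSteps (opt (X ω)) (Γ ω) : ℝ≥0∞) ∂P ≤ ENNReal.ofReal (2 ^ K * (2 * n ^ 2 + 1)
      + n * (2 ^ K * (4 * n ^ 2 + 1)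
        * (K * ((32 * n ^ 2 * 2 ^ K : ℝ) ^ (10 * K) * (8 * φ))))) := by
  classical
  have : ∀ e, IsProbabilityMeasure (𝒳 e) := fun e => (h𝒳 e).isProb
  -- `M i` bounds the number of steps when no window is slow at scale `ε i = 2^{-i}`. The events `B
  -- i` are measurable hulls of the slow events, with the same measure.
  let M : ℕ → ℕ := fun i => 2 ^ K * (2 * n ^ 2 * 2 ^ i + 1)
  let ε : ℕ → ℝ := fun i => (2 ^ i)⁻¹
  have hε : ∀ i, 0 < ε i := fun i => by positivity
  let B : ℕ → Set (Weights n) := fun i => toMeasurable (Measure.pi 𝒳) (slowWeights n (2 ^ K) (ε i))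
  have hBm : ∀ i, MeasurableSet (B i) := fun i => measurableSet_toMeasurable _ _
  have hbdd : ∀ᵐ ω ∂P, ∀ e, |X ω e| ≤ 1 :=
    ae_of_ae_map hX.aemeasurable (hX.map_eq ▸ ae_abs_le_one h𝒳)
  let f : Weights n → ℝ≥0∞ := fun Y => (M 0 : ℝ≥0∞)
    + ∑ i ∈ Finset.range n, (B i).indicator (fun _ => (M (i + 1) : ℝ≥0∞)) Y
  have hfm : Measurable f := by
    have hsum : Measurable fun Y => ∑ i ∈ Finset.range n,
        (B i).indicator (fun _ => (M (i + 1) : ℝ≥0∞)) Y :=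
      Finset.measurable_fun_sum _ fun i _ => measurable_const.indicator (hBm i)
    exact measurable_const.add hsum
  have hpt : ∀ᵐ ω ∂P, (numSteps (opt (X ω)) (Γ ω) : ℝ≥0∞) ≤ f (X ω) := by
    filter_upwards [hbdd, hΓ] with ω hω hex
    have hterm : ∀ i < n, X ω ∈ slowWeights n (2 ^ K) (ε i) → (M (i + 1) : ℝ≥0∞) ≤ f (X ω) := by
      intro i hi hslow
      have h1 : (M (i + 1) : ℝ≥0∞) = (B i).indicator (fun _ => (M (i + 1) : ℝ≥0∞)) (X ω) := by
        rw [Set.indicator_of_mem (subset_toMeasurable _ _ hslow)]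
      rw [h1]
      exact (Finset.single_le_sum (f := fun i =>
        (B i).indicator (fun _ => (M (i + 1) : ℝ≥0∞)) (X ω)) (fun _ _ => zero_le)
        (Finset.mem_range.2 hi)).trans le_add_self
    have hfast : ∀ i, X ω ∉ slowWeights n (2 ^ K) (ε i) →
        (numSteps (opt (X ω)) (Γ ω) : ℝ≥0∞) ≤ (M i : ℝ≥0∞) := by
      intro i hi
      have h1 := numSteps_le_of_notMem_slowWeights (M := 2 * n ^ 2 * 2 ^ i + 1) hω
        (hstep (X ω)) hex Nat.one_le_two_pow hi (by
          push_cast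
          have h2 : (2 : ℝ) ^ i * ε i = 1 := mul_inv_cancel₀ (by positivity)
          have h3 := hε i
          have h4 : (2 * (n : ℝ) ^ 2 * 2 ^ i + 1) * ε i = 2 * (n : ℝ) ^ 2 * (2 ^ i * ε i) + ε i := by
            ring
          rw [h4, h2]
          linarith)
      exact_mod_cast ENat.toENNReal_le.2 h1
    -- If all scales below `n` are slow, the trivial bound `2 ^ n ≤ M n` takes over. Otherwise the
    -- first scale `i` that is not slow gives at most `M i` steps, and for `i > 0` the slow scale `i
    -- - 1` pays for it.
    by_cases hall : ∀ i < n, X ω ∈ slowWeights n (2 ^ K) (ε i)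
    · obtain ⟨m, rfl⟩ : ∃ m, n = m + 1 := ⟨n - 1, by omega⟩
      refine le_trans ?_ (hterm m (by omega) (hall m (by omega)))
      have h1 := numSteps_le_two_pow (fun γ γ' h => (hstep (X ω) γ γ' h).2) hex
      have h2 : 2 ^ (m + 1) ≤ M (m + 1) := by
        have h3 : 1 ≤ 2 ^ K := Nat.one_le_two_pow
        have h4 : 1 ≤ 2 * (m + 1) ^ 2 := by nlinarith
        calc 2 ^ (m + 1) ≤ 2 * (m + 1) ^ 2 * 2 ^ (m + 1) := Nat.le_mul_of_pos_left _ h4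
          _ ≤ 2 * (m + 1) ^ 2 * 2 ^ (m + 1) + 1 := Nat.le_succ _
          _ ≤ M (m + 1) := Nat.le_mul_of_pos_left _ h3
      have h5 : numSteps (opt (X ω)) (Γ ω) ≤ (M (m + 1) : ℕ) := h1.trans (by exact_mod_cast h2)
      exact_mod_cast ENat.toENNReal_le.2 h5
    · push Not at hall
      have hex' : ∃ i, i < n ∧ X ω ∉ slowWeights n (2 ^ K) (ε i) := hall
      obtain ⟨hi1, hi2⟩ := Nat.find_spec hex'
      have hmin := fun m => Nat.find_min hex' (m := m)
      set i := Nat.find hex'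
      rcases Nat.eq_zero_or_pos i with h0 | h0
      · rw [h0] at hi2
        exact (hfast 0 hi2).trans le_self_add
      · have hprev : X ω ∈ slowWeights n (2 ^ K) (ε (i - 1)) := by
          by_contra h
          exact hmin (i - 1) (by omega) ⟨by omega, h⟩
        have h1 := hterm (i - 1) (by omega) hprev
        rw [show i - 1 + 1 = i by omega] at h1
        exact (hfast i hi2).trans h1
  calc ∫⁻ ω, (numSteps (opt (X ω)) (Γ ω) : ℝ≥0∞) ∂P ≤ ∫⁻ ω, f (X ω) ∂P := lintegral_mono_ae hpt
    _ = ∫⁻ Y, f Y ∂(Measure.pi 𝒳) := by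
        rw [← hX.map_eq, lintegral_map' hfm.aemeasurable hX.aemeasurable]
    _ = M 0 + ∑ i ∈ Finset.range n, (M (i + 1) : ℝ≥0∞) * Measure.pi 𝒳 (B i) := by
        rw [lintegral_add_left measurable_const, lintegral_const, measure_univ, mul_one,
          lintegral_finsetSum _ fun i _ => measurable_const.indicator (hBm i)]
        congr 1
        exact Finset.sum_congr rfl fun i _ => lintegral_indicator_const (hBm i) _
    _ ≤ M 0 + ∑ _i ∈ Finset.range n, ENNReal.ofReal (2 ^ K * (4 * n ^ 2 + 1)
        * (K * ((32 * n ^ 2 * 2 ^ K : ℝ) ^ (10 * K) * (8 * φ)))) := by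
        gcongr with i _
        have h1 : Measure.pi 𝒳 (B i) ≤ _ :=
          (measure_toMeasurable _).trans_le (measure_slowWeights_le hn hK hφ 𝒳 h𝒳 (hε i))
        rw [← ENNReal.ofReal_natCast]
        refine (mul_le_mul' le_rfl h1).trans ?_
        rw [← ENNReal.ofReal_mul (by positivity)]
        refine ENNReal.ofReal_le_ofReal ?_
        have h2 : (2 : ℝ) ^ i * ε i = 1 := mul_inv_cancel₀ (by positivity)
        have h3 : ε i ≤ 1 := inv_le_one_of_one_le₀ (one_le_pow₀ (by norm_num))
        -- The step bound grows like `2 ^ i` while the slow probability is proportional to `2 ^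
        -- (-i)`, so every scale contributes the same amount, and there are only `n` scales.
        have h4 : (M (i + 1) : ℝ) * ε i ≤ 2 ^ K * (4 * n ^ 2 + 1) := by
          have h5 : (M (i + 1) : ℝ) * ε i = 2 ^ K * (4 * n ^ 2 * (2 ^ i * ε i) + ε i) := by
            simp only [M]
            push_cast
            ring
          rw [h5, h2, mul_one]
          gcongr
        calc (M (i + 1) : ℝ) * (K * ((32 * n ^ 2 * 2 ^ K : ℝ) ^ (10 * K) * (8 * ε i * φ)))
            = (M (i + 1) : ℝ) * ε i * (K * ((32 * n ^ 2 * 2 ^ K : ℝ) ^ (10 * K) * (8 * φ))) := by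
              ring
          _ ≤ _ := by gcongr
    _ = _ := by
        rw [Finset.sum_const, Finset.card_range, ← ENNReal.ofReal_nsmul, nsmul_eq_mul,
          ← ENNReal.ofReal_natCast (M 0), ← ENNReal.ofReal_add (by positivity) (by positivity)]
        simp [M]

/-! ### Choice of the window length and final estimates -/

theorem two_pow_bounds {n : ℕ} (hn : 2 ≤ n) : ∃ K : ℕ, 2 * (n + 1) < 2 ^ K ∧
    (2 : ℝ) ^ K ≤ (n : ℝ) ^ 4 ∧ 1 ≤ K ∧ (K : ℝ) ≤ 6 * Real.log n := by
  have h1 : 2 * (n + 1) < 2 ^ (Nat.log 2 (2 * (n + 1)) + 1) :=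
    Nat.lt_pow_succ_log_self (by norm_num) _
  have h2 : 2 ^ Nat.log 2 (2 * (n + 1)) ≤ 2 * (n + 1) := Nat.pow_log_le_self 2 (by omega)
  have h3 : (2 : ℝ) ^ (Nat.log 2 (2 * (n + 1)) + 1) ≤ (n : ℝ) ^ 4 := by
    have h4 : 2 ^ (Nat.log 2 (2 * (n + 1)) + 1) ≤ n ^ 4 := by
      have h5 : 2 ^ 3 ≤ n ^ 3 := Nat.pow_le_pow_left hn 3
      calc 2 ^ (Nat.log 2 (2 * (n + 1)) + 1) = 2 ^ Nat.log 2 (2 * (n + 1)) * 2 := pow_succ _ _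
        _ ≤ 2 ^ 3 * n := by omega
        _ ≤ n ^ 3 * n := by gcongr
        _ = n ^ 4 := by ring
    exact_mod_cast h4
  refine ⟨_, h1, h3, by omega, ?_⟩
  have h4 := Real.log_le_log (by positivity) h3
  rw [Real.log_pow, Real.log_pow] at h4
  have h5 := Real.log_two_gt_d9
  have h6 : 0 ≤ ((Nat.log 2 (2 * (n + 1)) + 1 : ℕ) : ℝ) := by positivity
  push_cast at h4 h6 ⊢
  -- From `K log 2 ≤ 4 log n`, as `4 / log 2 < 6`.
  nlinarith

/-- The quasi-polynomial bound absorbs all the polynomial factors. -/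
theorem steps_bound_le {n K : ℕ} (hn : 2 ≤ n) (hK1 : 1 ≤ K) (hK : (2 : ℝ) ^ K ≤ (n : ℝ) ^ 4)
    (hKlog : (K : ℝ) ≤ 6 * Real.log n) {φ : ℝ} (hφ : 1 / 2 ≤ φ) :
    2 ^ K * (2 * (n : ℝ) ^ 2 + 1)
      + n * (2 ^ K * (4 * n ^ 2 + 1) * (K * ((32 * n ^ 2 * 2 ^ K : ℝ) ^ (10 * K) * (8 * φ))))
      ≤ φ * (n : ℝ) ^ ((400000 : ℝ) * Real.log n ^ 10) := by
  have hn2 : (2 : ℝ) ≤ n := by exact_mod_cast hn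
  have hn1 : (1 : ℝ) ≤ n := by linarith
  have hpow : ∀ k : ℕ, (2 : ℝ) ^ k ≤ (n : ℝ) ^ k := fun k => by gcongr
  have h32 : (32 : ℝ) ≤ (n : ℝ) ^ 5 := by have := hpow 5; norm_num at this; exact this
  have h64 : (64 : ℝ) ≤ (n : ℝ) ^ 6 := by have := hpow 6; norm_num at this; exact this
  have hKn : (K : ℝ) ≤ (n : ℝ) ^ 4 := by
    refine le_trans ?_ hK
    exact_mod_cast (Nat.lt_two_pow_self (n := K)).le
  have hK1' : (1 : ℝ) ≤ K := by exact_mod_cast hK1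
  set Q : ℝ := (n : ℝ) ^ (110 * K) with hQ
  have hQ1 : 1 ≤ Q := one_le_pow₀ hn1
  have hR : (32 * n ^ 2 * 2 ^ K : ℝ) ^ (10 * K) ≤ Q := by
    calc (32 * n ^ 2 * 2 ^ K : ℝ) ^ (10 * K) ≤ ((n : ℝ) ^ 5 * n ^ 2 * n ^ 4) ^ (10 * K) := by gcongr
      _ = Q := by rw [hQ, ← pow_add, ← pow_add, ← pow_mul]; congr 1; ring
  have hφ0 : 0 < φ := by linarith
  have hsq : (1 : ℝ) ≤ (n : ℝ) ^ 2 := one_le_pow₀ hn1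
  have hfirst : 2 ^ K * (2 * (n : ℝ) ^ 2 + 1) ≤ φ * (6 * (n : ℝ) ^ 11 * Q) := by
    calc 2 ^ K * (2 * (n : ℝ) ^ 2 + 1) ≤ n ^ 4 * (2 * (n : ℝ) ^ 2 + n ^ 2) := by gcongr
      _ = 1 / 2 * (6 * (n : ℝ) ^ 6 * 1) := by ring
      _ ≤ φ * (6 * (n : ℝ) ^ 11 * Q) := by
        gcongr
        norm_num
  have hsecond : (n : ℝ) * (2 ^ K * (4 * n ^ 2 + 1)
      * (K * ((32 * n ^ 2 * 2 ^ K : ℝ) ^ (10 * K) * (8 * φ)))) ≤ φ * (40 * (n : ℝ) ^ 11 * Q) := by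
    calc (n : ℝ) * (2 ^ K * (4 * n ^ 2 + 1)
          * (K * ((32 * n ^ 2 * 2 ^ K : ℝ) ^ (10 * K) * (8 * φ))))
        ≤ (n : ℝ) * (n ^ 4 * (4 * n ^ 2 + n ^ 2) * (n ^ 4 * (Q * (8 * φ)))) := by gcongr
      _ = φ * (40 * (n : ℝ) ^ 11 * Q) := by ring
  -- The exponent obtained is only of order `log n`. Since `log n ≥ 1/2`, it is at most `762 · 2^9 ·
  -- log^10 n`, and `762 · 2^9 = 390144 ≤ 400000`.
  have hexp : (n : ℝ) ^ (17 + 110 * K) ≤ (n : ℝ) ^ ((400000 : ℝ) * Real.log n ^ 10) := by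
    rw [← Real.rpow_natCast]
    refine Real.rpow_le_rpow_of_exponent_le hn1 ?_
    have hlog : 1 / 2 ≤ Real.log n := by
      have h1 := Real.log_two_gt_d9
      have h2 := Real.log_le_log (by norm_num) hn2
      linarith
    have h9 : (1 / 2 : ℝ) ^ 9 ≤ Real.log n ^ 9 := by gcongr
    push_cast
    calc (17 : ℝ) + 110 * K ≤ 127 * K := by linarith
      _ ≤ 127 * (6 * Real.log n) := by gcongr
      _ ≤ 400000 * ((1 / 2 : ℝ) ^ 9 * Real.log n) := by
        have : 0 ≤ Real.log n := by linarith
        norm_num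
        linarith
      _ ≤ 400000 * (Real.log n ^ 9 * Real.log n) := by
        gcongr
      _ = 400000 * Real.log n ^ 10 := by ring
  calc _ ≤ φ * (6 * (n : ℝ) ^ 11 * Q) + φ * (40 * (n : ℝ) ^ 11 * Q) := add_le_add hfirst hsecond
    _ = φ * (46 * ((n : ℝ) ^ 11 * Q)) := by ring
    _ ≤ φ * ((n : ℝ) ^ 6 * ((n : ℝ) ^ 11 * Q)) := by gcongr; linarith
    _ = φ * (n : ℝ) ^ (17 + 110 * K) := by rw [hQ, ← pow_add, ← pow_add]; congr 2; ring
    _ ≤ _ := by gcongr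

/-- The quasi-polynomial bound for any local search with steps flipping at most two nodes. -/
theorem lintegral_numSteps_le {n : ℕ} (hn : 1 ≤ n) {φ : ℝ} (hφ : 0 < φ)
    (𝒳 : Edge n → Measure ℝ) (h𝒳 : ∀ e, IsSmoothed φ (𝒳 e))
    {Ω : Type*} [MeasurableSpace Ω] (P : Measure Ω) [IsProbabilityMeasure P]
    (X : Ω → Weights n) (hX : HasLaw X (Measure.pi 𝒳) P) (Γ : Ω → ℕ → Config n)
    (step : Weights n → Config n → Config n → Prop) (opt : Weights n → Config n → Prop)
    (hstep : ∀ X γ γ', step X γ γ' → hammingDist γ γ' ≤ 2 ∧ obj X γ < obj X γ')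
    (hopt : ∀ X γ, (∀ γ', obj X γ' ≤ obj X γ) → opt X γ)
    (hΓ : ∀ᵐ ω ∂P, IsExecution (step (X ω)) (opt (X ω)) (Γ ω)) :
    ∫⁻ ω, (numSteps (opt (X ω)) (Γ ω) : ℝ≥0∞) ∂P
      ≤ ENNReal.ofReal (φ * (n : ℝ) ^ ((400000 : ℝ) * Real.log n ^ 10)) := by
  rcases Nat.lt_or_ge n 2 with hlt | hn2
  · obtain rfl : n = 1 := by omega
    -- With a single node there are no edges, so the initial configuration is already optimal. This
    -- case is separate because `log 1 = 0` and no edge is available to give `φ ≥ 1/2`.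
    have hzero : ∀ (Y : Weights 1) (γ : Config 1), obj Y γ = 0 := fun Y γ =>
      Finset.sum_eq_zero fun e _ => absurd e.2 (by simp [Subsingleton.elim e.1.1 e.1.2])
    have hnum : ∀ ω, numSteps (opt (X ω)) (Γ ω) = 0 := fun ω => by
      have h : numSteps (opt (X ω)) (Γ ω) ≤ (0 : ℕ) :=
        numSteps_le_of_exists ⟨0, le_rfl, hopt _ _ fun γ' => by rw [hzero, hzero]⟩
      simpa using h
    simp [hnum]
  · obtain ⟨K, hK, hKpow, hK1, hKlog⟩ := two_pow_bounds hn2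
    refine (lintegral_numSteps_le_sum hn hK hφ 𝒳 h𝒳 P X hX Γ step opt hstep hΓ).trans
      (ENNReal.ofReal_le_ofReal (steps_bound_le hn2 hK1 hKpow hKlog ?_))
    exact half_le_of_isSmoothed (h𝒳 ⟨(⟨0, by omega⟩, ⟨1, by omega⟩), by simp⟩)

end LocalMaxCut

theorem corollary3p4 :
    ∃ C : ℝ, 0 < C ∧
      ∀ (n : ℕ), 1 ≤ n → ∀ (φ : ℝ), 0 < φ →
      ∀ (𝒳 : LocalMaxCut.Edge n → Measure ℝ), (∀ e, LocalMaxCut.IsSmoothed φ (𝒳 e)) →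
      -- independent edge weights `X e` with distributions `𝒳 e`, on a probability space that
      -- may carry further randomness for the implementation to use
      ∀ (Ω : Type*) [MeasurableSpace Ω] (P : Measure Ω) [IsProbabilityMeasure P]
        (X : Ω → LocalMaxCut.Weights n), HasLaw X (Measure.pi 𝒳) P →
      -- the execution produced by the implementation
      ∀ (Γ : Ω → ℕ → LocalMaxCut.Config n),
      ((∀ᵐ ω ∂P, LocalMaxCut.IsExecution (LocalMaxCut.TwoFlipStep (X ω))
            (LocalMaxCut.TwoFlipOpt (X ω)) (Γ ω)) →
        ∫⁻ ω, (LocalMaxCut.numSteps (LocalMaxCut.TwoFlipOpt (X ω)) (Γ ω) : ℝ≥0∞) ∂P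
          ≤ ENNReal.ofReal (φ * (n : ℝ) ^ (C * Real.log n ^ 10))) ∧
      ((∀ᵐ ω ∂P, LocalMaxCut.IsExecution (LocalMaxCut.PureTwoFlipStep (X ω))
            (LocalMaxCut.PureTwoFlipOpt (X ω)) (Γ ω)) →
        ∫⁻ ω, (LocalMaxCut.numSteps (LocalMaxCut.PureTwoFlipOpt (X ω)) (Γ ω) : ℝ≥0∞) ∂P
          ≤ ENNReal.ofReal (φ * (n : ℝ) ^ (C * Real.log n ^ 10))) := by
  refine ⟨400000, by norm_num, fun n hn φ hφ 𝒳 h𝒳 Ω _ P _ X hX Γ => ⟨fun h => ?_, fun h => ?_⟩⟩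
  · exact LocalMaxCut.lintegral_numSteps_le hn hφ 𝒳 h𝒳 P X hX Γ LocalMaxCut.TwoFlipStep
      LocalMaxCut.TwoFlipOpt (fun _ _ _ h => ⟨h.dist_le, h.improving⟩) (fun _ _ h γ' _ => h γ') h
  · exact LocalMaxCut.lintegral_numSteps_le hn hφ 𝒳 h𝒳 P X hX Γ LocalMaxCut.PureTwoFlipStep
      LocalMaxCut.PureTwoFlipOpt (fun _ _ _ h => ⟨h.dist_eq.le, h.improving⟩)
      (fun _ _ h γ' _ => h γ') h
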